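/- Let $a,b\in\mathbb R$ with $a\neq0$, $b\neq0$, $c:=-a-b\neq0$. Let $H(3,1)$ be the group of real matrices $$\begin{pmatrix}1&x_1&x_2&x_3&z\\0&1&0&0&y_1\\0&0&1&0&y_2\\0&0&0&1&y_3\\0&0&0&0&1\end{pmatrix},$$ $\Gamma(3,1)$ its subgroup of integer matrices and $N(3,1)=\Gamma(3,1)\backslash H(3,1)$. Consider the left invariant coframe $e^1=\frac1a dx_1$, $e^2=dy_1$, $e^3=\frac1b dx_2$, $e^4=dy_2$, $e^5=\frac1c dx_3$, $e^6=dy_3$, $e^7=x_1dy_1+x_2dy_2+x_3dy_3-dz$, with dual frame $E_1,\dots,E_7$, declare it oriented and orthonormal, let $g$ be the resulting metric, $\Theta=e^{127}+e^{347}+e^{567}+e^{135}-e^{146}-e^{236}-e^{245}$, $T=-*d\Theta$, and $\nabla^+=\nabla^g+\frac12T$. For $\lambda,\mu,\tau\in\mathbb R$ let $A=A_{\lambda,\mu,\tau}$ be the connection on the tangent bundle with connection forms $\sigma^1_2=-\sigma^2_1=\lambda e^7$, $\sigma^3_4=-\sigma^4_3=\mu e^7$, $\sigma^5_6=-\sigma^6_5=\tau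 e^7$ and all others zero (where $\nabla_XE_j=\sum_i\sigma^i_j(X)E_i$). For a metric connection with curvature forms $\Omega^i_j=d\sigma^i_j+\sum_k\sigma^i_k\wedge\sigma^k_j$ put $p_1=\frac1{8\pi^2}\sum_{i<j}\Omega^i_j\wedge\Omega^i_j$. Assume $(\lambda,\mu,\tau)\neq(0,0,0)$ and $\lambda^2+\mu^2+\tau^2<2(a^2+ab+b^2)$, and set $$\alpha'=\frac{4}{2(a^2+ab+b^2)-\lambda^2-\mu^2-\tau^2}>0 .$$ Then $N(3,1)$ is a compact manifold, all the above objects descend to it, $g$ is the metric induced by $\Theta$, and: 1. $\Theta$ is cocalibrated of pure type, $d{*\Theta}=0=d\Theta\wedge\Theta$, and $A$ is a $G_2$-instanton: it is metric, and its curvature forms satisfy $\sum_{k,l}\Omega(E_k,E_l)\,{*\Theta}(E_m,E_n,E_k,E_l)=-2\,\Omega(E_m,E_n)$. 2. $dT=2\pi^2\alpha'\,\bigl(p_1(\nabla^+)-p_1(A)\bigr)$. 3. With $H=T$ and any constant dilaton $\phi$, there is a nowhere vanishing smooth real spinor field $\epsilon$ on $N(3,1)$ (for the spin structure given by the global frame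 $E_i$) satisfying the supersymmetry equations $\nabla^+\epsilon=0$, $(d\phi-\frac12H)\cdot\epsilon=0$ and $F^A\cdot\epsilon=0$. 4. With $H=T$, the same $\phi$ and $\alpha'$, and the curvature $R$ of $\nabla^+$, the equations of motion hold: $$\mathrm{Ric}^g_{ij}-\tfrac14H_{imn}H_j{}^{mn}+2\nabla^g_i\nabla^g_j\phi-\tfrac{\alpha'}4\sum_m\Bigl[\langle F^A_{im},F^A_{jm}\rangle-\langle R_{im},R_{jm}\rangle\Bigr]=0,$$ $$\nabla^g_i(e^{-2\phi}H^i{}_{jk})=0,\qquad\nabla^+_i(e^{-2\phi}(F^A)^i{}_j)=0,$$ where $\langle M,N\rangle=\sum_{p<q}M^p_qN^p_q$ is the inner product on skew-symmetric matrices that is used in $p_1$, and the last equation is gauge covariant (with $A$ acting on the gauge indices). 5. The flux $T$ and the curvature of $A$ vanish nowhere. In the coordinates above, $$g=\tfrac1{a^2}dx_1^2+dy_1^2+\tfrac1{b^2}dx_2^2+dy_2^2+\tfrac1{(a+b)^2}dx_3^2+dy_3^2+(x_1dy_1+x_2dy_2+x_3dy_3-dz)^2 .$$ -/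

import Mathlib

open scoped ContDiff

noncomputable section

namespace Heterotic

/-! ## Differential forms on `ℝ⁷` -/

/-- The global coordinate space `ℝ⁷`, with coordinates ordered as `(x₁, y₁, x₂, y₂, x₃, y₃, z)`. -/
abbrev V : Type := Fin 7 → ℝ

/-- Differential `k`-forms on `ℝ⁷`; their exterior derivative is Mathlib's `extDeriv`. -/
abbrev Form (k : ℕ) : Type := V → V [⋀^Fin k]→L[ℝ] ℝ

/-- The wedge product of two alternating forms, as a sum over shuffles, so that for `1`-forms
`(α ∧ β) (v, w) = α v * β w - α w * β v`. -/
def wedgeAlt {k l : ℕ} (α : V [⋀^Fin k]→L[ℝ] ℝ) (β : V [⋀^Fin l]→L[ℝ] ℝ) :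
    V [⋀^Fin (k + l)]→L[ℝ] ℝ :=
  { ((LinearMap.mul' ℝ ℝ).compAlternatingMap
      (α.toAlternatingMap.domCoprod β.toAlternatingMap)).domDomCongr finSumFinEquiv with
    cont := by
      change Continuous fun v : Fin (k + l) → V =>
        LinearMap.mul' ℝ ℝ ((α.toAlternatingMap.domCoprod β.toAlternatingMap)
          fun i => v (finSumFinEquiv i))
      simp only [AlternatingMap.domCoprod_apply, sum_apply, map_sum]
      refine continuous_finsetSum _ fun σ _ => ?_
      induction σ using Quotient.inductionOn' with
      | h σ =>
        have h : Continuous fun v : Fin (k + l) → V => (Equiv.Perm.sign σ : ℤ) •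
            (α (fun i => v (finSumFinEquiv (σ (Sum.inl i)))) *
              β fun i => v (finSumFinEquiv (σ (Sum.inr i)))) := by
          have h₁ : Continuous fun v : Fin (k + l) → V =>
              α fun i => v (finSumFinEquiv (σ (Sum.inl i))) :=
            α.coe_continuous.comp (continuous_pi fun i => continuous_apply _)
          have h₂ : Continuous fun v : Fin (k + l) → V =>
              β fun i => v (finSumFinEquiv (σ (Sum.inr i))) :=
            β.coe_continuous.comp (continuous_pi fun i => continuous_apply _)
          exact (h₁.mul h₂).const_smul (Equiv.Perm.sign σ : ℤ)
        refine h.congr fun v => ?_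
        rw [AlternatingMap.domCoprod.summand_mk'']
        rcases Int.units_eq_one_or (Equiv.Perm.sign σ) with hs | hs <;> rw [hs] <;>
          simp [MultilinearMap.domCoprod_apply] }

/-- The wedge product of differential forms. -/
def wedge {k l : ℕ} (α : Form k) (β : Form l) : Form (k + l) := fun x => wedgeAlt (α x) (β x)

/-- The constant form `dx^{I 0} ∧ ⋯ ∧ dx^{I (k-1)}` on `ℝ⁷`,
i.e. `v ↦ det (v_a^{I b})`. -/
def stdForm {k : ℕ} (I : Fin k → Fin 7) : V [⋀^Fin k]→L[ℝ] ℝ :=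
  ContinuousMultilinearMap.alternatization
    ((ContinuousMultilinearMap.mkPiAlgebra ℝ (Fin k) ℝ).compContinuousLinearMap
      fun a => (ContinuousLinearMap.proj (I a) : V →L[ℝ] ℝ))

/-- The Levi-Civita symbol: the sign of `f` if `f` is a permutation, and `0` otherwise. -/
def leviCivitaSymbol {n : ℕ} (f : Fin n → Fin n) : ℤ :=
  ∏ p : Fin n, ∏ q ∈ Finset.Ioi p, Int.sign (((f q : ℕ) : ℤ) - ((f p : ℕ) : ℤ))

/-! ## Moving coframes and the geometry they define

A smooth global coframe `(e¹, …, e⁷)` on `ℝ⁷`, with dual frame `(E₁, …, E₇)`, is declared to be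
oriented, orthonormal and `G₂`-adapted. Indices run over `Fin 7`, so `e¹` has index `0`. -/

/-- A smooth global coframe together with its dual frame. -/
structure Coframe where
  /-- `coframe x v = (e¹_x(v), …, e⁷_x(v))` -/
  coframe : V → V →L[ℝ] V
  /-- the dual vector fields `E₁, …, E₇` -/
  frame : Fin 7 → V → V
  smooth_coframe : ContDiff ℝ ∞ coframe
  smooth_frame : ∀ i, ContDiff ℝ ∞ (frame i)
  dual : ∀ x i, coframe x (frame i x) = Pi.single i 1

namespace Coframe

variable (e : Coframe)

/-- The form `e^{I 0} ∧ ⋯ ∧ e^{I (k-1)}`. -/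
def form {k : ℕ} (I : Fin k → Fin 7) : Form k :=
  fun x => (stdForm I).compContinuousLinearMap (e.coframe x)

/-- The component `α(E_{I 0}, …, E_{I (k-1)})` of a form. -/
def comp {k : ℕ} (α : Form k) (x : V) (I : Fin k → Fin 7) : ℝ :=
  α x fun a => e.frame (I a) x

/-- The Riemannian metric `e¹ ⊗ e¹ + ⋯ + e⁷ ⊗ e⁷`. -/
def metric (x v w : V) : ℝ := ∑ i, e.coframe x v i * e.coframe x w i

/-- The Hodge star of the metric and of the orientation `e^{1234567}`:
`* e^I = ∑_J ε(I, J) e^J`, the sums being over increasing multi-indices. -/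
def hodge {k l : ℕ} (h : k + l = 7) (α : Form k) : Form l := fun x =>
  ∑ I : Fin k ↪o Fin 7, ∑ J : Fin l ↪o Fin 7,
    ((leviCivitaSymbol fun p : Fin 7 => Fin.append I J (Fin.cast h.symm p) : ℝ) *
      e.comp α x I) • e.form J x

/-- The fundamental form of the `G₂`-structure,
`Θ = e¹²⁷ - e²³⁶ + e³⁴⁷ + e⁵⁶⁷ - e¹⁴⁶ - e²⁴⁵ + e¹³⁵`. -/
def theta : Form 3 :=
  e.form ![0, 1, 6] - e.form ![1, 2, 5] + e.form ![2, 3, 6] + e.form ![4, 5, 6]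
    - e.form ![0, 3, 5] - e.form ![1, 3, 4] + e.form ![0, 2, 4]

/-- The `4`-form `*Θ`. -/
def starTheta : Form 4 := e.hodge (by norm_num) e.theta

/-- The metric is the one induced by `Θ`: `g_{ij} = (1/6) ∑_{k,l} Θ_{ikl} Θ_{jkl}`. -/
def MetricInducedByTheta : Prop :=
  ∀ x v w, e.metric x v w =
    1 / 6 * ∑ k, ∑ l, e.theta x ![v, e.frame k x, e.frame l x] *
      e.theta x ![w, e.frame k x, e.frame l x]

/-- The `G₂`-structure is cocalibrated of pure type: `d*Θ = 0` and `dΘ ∧ Θ = 0`. -/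
def CocalibratedOfPureType : Prop :=
  extDeriv e.starTheta = 0 ∧ wedge (extDeriv e.theta) e.theta = 0

/-- The torsion `3`-form `T = -*dΘ` of a cocalibrated `G₂`-structure of pure type. -/
def torsion : Form 3 := -e.hodge (k := 4) (by norm_num) (extDeriv e.theta)

end Coframe

/-! ### Connections -/

/-- A connection on the tangent bundle, given with respect to a frame by its connection forms
`σ i j = σ^i_j`, where `∇_X E_j = ∑ i, σ^i_j(X) E_i`. -/
abbrev Conn : Type := Fin 7 → Fin 7 → Form 1

/-- The connection preserves the metric (of an orthonormal frame). -/
def Conn.IsMetric (σ : Conn) : Prop := ∀ i j, σ i j = -σ j i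

/-- The curvature forms `Ω^i_j = dσ^i_j + ∑ k, σ^i_k ∧ σ^k_j`. -/
def Conn.curvature (σ : Conn) (i j : Fin 7) : Form 2 :=
  extDeriv (σ i j) + ∑ k, wedge (σ i k) (σ k j)

/-- The first Pontrjagin form `p₁ = (1 / 8π²) ∑_{i < j} Ω^i_j ∧ Ω^i_j`. -/
def Conn.pontrjagin (σ : Conn) : Form 4 :=
  (1 / (8 * Real.pi ^ 2)) •
    ∑ i, ∑ j ∈ Finset.Ioi i, wedge (σ.curvature i j) (σ.curvature i j)

namespace Coframe

variable (e : Coframe)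

/-- `structureFn k i j x = a_{ij}^k = de^k(E_i, E_j)`. -/
def structureFn (k i j : Fin 7) (x : V) : ℝ := e.comp (k := 2) (extDeriv (e.form ![k])) x ![i, j]

/-- The Levi-Civita connection of the metric, by the Koszul formula in an orthonormal frame:
`σ^i_j(E_k) = (a_{jk}^i - a_{ij}^k + a_{ki}^j) / 2`. -/
def leviCivita : Conn := fun i j x =>
  ∑ k, (1 / 2 * (e.structureFn i j k x - e.structureFn k i j x + e.structureFn j k i x)) •
    e.form ![k] x

/-- The metric connection `∇⁺ = ∇ᵍ + H/2` with torsion `H`, that is,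
`g(∇⁺_X Y, Z) = g(∇ᵍ_X Y, Z) + H(X, Y, Z) / 2`. -/
def plusConn (H : Form 3) : Conn := fun i j x =>
  e.leviCivita i j x + ∑ k, (1 / 2 * e.comp H x ![k, j, i]) • e.form ![k] x

/-- The components `Ric_{mn} = ∑ i, R_{imni}` of the Ricci tensor, where
`R_{ijkl} = Ω^l_k(E_i, E_j)`. -/
def ricci (σ : Conn) (m n : Fin 7) (x : V) : ℝ := ∑ i, e.comp (σ.curvature i n) x ![i, m]

/-- The components `(∇_{E_i} t)(E_{I 0}, …, E_{I (k-1)})` of the covariant derivative of a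
covariant tensor field with components `t`. -/
def covDeriv (σ : Conn) {k : ℕ} (t : V → (Fin k → Fin 7) → ℝ) (x : V) (i : Fin 7)
    (I : Fin k → Fin 7) : ℝ :=
  fderiv ℝ (fun y => t y I) x (e.frame i x)
    - ∑ a, ∑ s, e.comp (σ s (I a)) x ![i] * t x (Function.update I a s)

/-- The connection is a metric connection whose curvature is of `G₂`-instanton type:
`∑_{k,l} Ω(E_k, E_l) *Θ(E_m, E_n, E_k, E_l) = -2 Ω(E_m, E_n)`. -/
def IsG2Instanton (A : Conn) : Prop :=
  A.IsMetric ∧ ∀ p q m n x,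
    ∑ k, ∑ l, e.comp (A.curvature p q) x ![k, l] * e.comp e.starTheta x ![m, n, k, l] =
      -2 * e.comp (A.curvature p q) x ![m, n]

end Coframe

/-! ### Spinors -/

/-- Index set of a basis of the real `8`-dimensional spinor module. -/
abbrev SpinIdx : Type := Fin 2 × Fin 2 × Fin 2

/-- The real spinor module in dimension seven. -/
abbrev Spinor : Type := SpinIdx → ℝ

/-- The real `2 × 2` matrix `ε` with `ε² = -1`. -/
def pauliE : Matrix (Fin 2) (Fin 2) ℝ := !![0, 1; -1, 0]

/-- The real Pauli matrix `σ₁`. -/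
def pauli1 : Matrix (Fin 2) (Fin 2) ℝ := !![0, 1; 1, 0]

/-- The real Pauli matrix `σ₃`. -/
def pauli3 : Matrix (Fin 2) (Fin 2) ℝ := !![1, 0; 0, -1]

open scoped Kronecker in
/-- The gamma matrices: an irreducible real representation of the Clifford algebra of `ℝ⁷`. -/
def gamma : Fin 7 → Matrix SpinIdx SpinIdx ℝ :=
  ![pauliE ⊗ₖ (pauli1 ⊗ₖ 1), pauliE ⊗ₖ (pauli3 ⊗ₖ 1), 1 ⊗ₖ (pauliE ⊗ₖ pauli1),
    1 ⊗ₖ (pauliE ⊗ₖ pauli3), pauli1 ⊗ₖ (1 ⊗ₖ pauliE), pauli3 ⊗ₖ (1 ⊗ₖ pauliE),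
    pauliE ⊗ₖ (pauliE ⊗ₖ pauliE)]

open scoped Kronecker in
/-- The Clifford relations `γ_i γ_j + γ_j γ_i = -2 δ_{ij}`. -/
theorem gamma_clifford (i j : Fin 7) :
    gamma i * gamma j + gamma j * gamma i = if i = j then -2 else 0 := by
  have nk {m n : Type} (A : Matrix m m ℝ) (B : Matrix n n ℝ) : (-A) ⊗ₖ B = -(A ⊗ₖ B) := by
    ext; simp
  have kn {m n : Type} (A : Matrix m m ℝ) (B : Matrix n n ℝ) : A ⊗ₖ (-B) = -(A ⊗ₖ B) := by
    ext; simp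
  have ee : pauliE * pauliE = -1 := by ext i j; fin_cases i <;> fin_cases j <;> simp [pauliE]
  have e1 : pauliE * pauli1 = pauli3 := by
    ext i j; fin_cases i <;> fin_cases j <;> simp [pauliE, pauli1, pauli3]
  have e3 : pauliE * pauli3 = -pauli1 := by
    ext i j; fin_cases i <;> fin_cases j <;> simp [pauliE, pauli1, pauli3]
  have f1 : pauli1 * pauliE = -pauli3 := by
    ext i j; fin_cases i <;> fin_cases j <;> simp [pauliE, pauli1, pauli3]
  have f3 : pauli3 * pauliE = pauli1 := by
    ext i j; fin_cases i <;> fin_cases j <;> simp [pauliE, pauli1, pauli3]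
  have s11 : pauli1 * pauli1 = 1 := by ext i j; fin_cases i <;> fin_cases j <;> simp [pauli1]
  have s33 : pauli3 * pauli3 = 1 := by ext i j; fin_cases i <;> fin_cases j <;> simp [pauli3]
  have s13 : pauli1 * pauli3 = -pauliE := by
    ext i j; fin_cases i <;> fin_cases j <;> simp [pauliE, pauli1, pauli3]
  have s31 : pauli3 * pauli1 = pauliE := by
    ext i j; fin_cases i <;> fin_cases j <;> simp [pauliE, pauli1, pauli3]
  have two : (-1 : Matrix SpinIdx SpinIdx ℝ) + -1 = -2 := by norm_num
  fin_cases i <;> fin_cases j <;>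
    simp [gamma, ← Matrix.mul_kronecker_mul, ee, e1, e3, f1, f3, s11, s33, s13, s31, nk, kn,
      two]

namespace Coframe

variable (e : Coframe)

/-- The spinorial covariant derivative
`∇_{E_k} ε = E_k(ε) + (1/4) ∑_{i,j} g(∇_{E_k} E_j, E_i) γ_j γ_i ε`, in the trivialization of the
spinor bundle by the orthonormal frame. -/
def spinDeriv (σ : Conn) (ε : V → Spinor) (x : V) (k : Fin 7) : Spinor :=
  fderiv ℝ ε x (e.frame k x) +
    (1 / 4 : ℝ) • ∑ i, ∑ j, e.comp (σ i j) x ![k] • (gamma j * gamma i).mulVec (ε x)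

/-- The heterotic Killing spinor equations for a spinor field `ε`, with flux `H`, dilaton `φ` and
gauge connection `A`. -/
structure KillingSpinorEquations (H : Form 3) (φ : V → ℝ) (A : Conn) (ε : V → Spinor) : Prop where
  /-- `∇⁺ ε = 0` -/
  gravitino : ∀ x k, e.spinDeriv (e.plusConn H) ε x k = 0
  /-- `(∂_m φ Γ^m - (1/12) H_{mnp} Γ^{mnp}) ε = 0` -/
  dilatino : ∀ x, ∑ m, fderiv ℝ φ x (e.frame m x) • (gamma m).mulVec (ε x)
    - (1 / 12 : ℝ) • ∑ m, ∑ n, ∑ p,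
        e.comp H x ![m, n, p] • (gamma m * gamma n * gamma p).mulVec (ε x) = 0
  /-- `F^A_{mn} Γ^{mn} ε = 0` -/
  gaugino : ∀ x p q, ∑ m, ∑ n,
    e.comp (A.curvature p q) x ![m, n] • (gamma m * gamma n).mulVec (ε x) = 0

/-! ### Anomaly cancellation and equations of motion -/

/-- The contraction `∑ m, ⟨R(E_i, E_m), R(E_j, E_m)⟩` of the curvature of a metric connection with
itself, where `⟨M, N⟩ = ∑_{p < q} M^p_q N^p_q` is the invariant inner product on skew-symmetric
matrices by which the first Pontrjagin form is defined (half of the sum over all `p, q`). -/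
def curvatureSquare (σ : Conn) (i j : Fin 7) (x : V) : ℝ :=
  ∑ m, ∑ p, ∑ q ∈ Finset.Ioi p,
    e.comp (σ.curvature p q) x ![i, m] * e.comp (σ.curvature p q) x ![j, m]

/-- The heterotic equations of motion, with flux `H`, dilaton `φ`, curvature term given by the
connection `B` on the tangent bundle, gauge connection `A` and constant `α'`. -/
structure EquationsOfMotion (H : Form 3) (φ : V → ℝ) (B A : Conn) (α' : ℝ) : Prop where
  /-- `Ricᵍ_{ij} - (1/4) H_{imn} H_{jmn} + 2 ∇ᵍ_i ∇ᵍ_j φ - (α'/4) (⟨F^A, F^A⟩ - ⟨R, R⟩)_{ij} = 0` -/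
  einstein : ∀ x i j,
    e.ricci e.leviCivita i j x
      - 1 / 4 * ∑ m, ∑ n, e.comp H x ![i, m, n] * e.comp H x ![j, m, n]
      + 2 * e.covDeriv e.leviCivita
          (fun y (I : Fin 1 → Fin 7) => fderiv ℝ φ y (e.frame (I 0) y)) x i ![j]
      - α' / 4 * (e.curvatureSquare A i j x - e.curvatureSquare B i j x) = 0
  /-- `∇ᵍ_i (e^{-2φ} H_{ijk}) = 0` -/
  flux : ∀ x j k,
    ∑ i, e.covDeriv e.leviCivita (fun y => Real.exp (-2 * φ y) • e.comp H y) x i ![i, j, k] = 0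
  /-- `∇⁺_i (e^{-2φ} F^A_{ij}) = 0`, where `∇⁺` acts on the form indices
  and `A` on the gauge indices -/
  gauge : ∀ x j p q,
    ∑ i, (e.covDeriv (e.plusConn H)
        (fun y => Real.exp (-2 * φ y) • e.comp (A.curvature p q) y) x i ![i, j]
      + Real.exp (-2 * φ x) * ∑ s,
        (e.comp (A p s) x ![i] * e.comp (A.curvature s q) x ![i, j]
          - e.comp (A.curvature p s) x ![i, j] * e.comp (A s q) x ![i])) = 0

end Coframe

/-! ## The generalized Heisenberg nilmanifold `N(3,1) = Γ(3,1) \ H(3,1)` -/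

/-- The generalized Heisenberg group `H(3,1)`, in its global coordinates. -/
def Heis : Type := V

/-- The matrix with coordinates `(x₁, y₁, x₂, y₂, x₃, y₃, z)`. -/
def heisMatrix (p : V) : Matrix (Fin 5) (Fin 5) ℝ :=
  !![1, p 0, p 2, p 4, p 6;
     0, 1, 0, 0, p 1;
     0, 0, 1, 0, p 3;
     0, 0, 0, 1, p 5;
     0, 0, 0, 0, 1]

/-- The product of `H(3,1)` in coordinates. -/
def heisMul (p q : V) : V :=
  ![p 0 + q 0, p 1 + q 1, p 2 + q 2, p 3 + q 3, p 4 + q 4, p 5 + q 5,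
    p 6 + q 6 + (p 0 * q 1 + p 2 * q 3 + p 4 * q 5)]

/-- The inverse of `H(3,1)` in coordinates. -/
def heisInv (p : V) : V :=
  ![-p 0, -p 1, -p 2, -p 3, -p 4, -p 5, -p 6 + (p 0 * p 1 + p 2 * p 3 + p 4 * p 5)]

theorem heisMatrix_injective : Function.Injective heisMatrix := by
  intro p q h
  have h' := fun i j => congrFun (congrFun h i) j
  funext i
  fin_cases i
  · exact h' 0 1
  · exact h' 1 4
  · exact h' 0 2
  · exact h' 2 4
  · exact h' 0 3
  · exact h' 3 4
  · exact h' 0 4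

/-- The product of `H(3,1)` is matrix multiplication. -/
theorem heisMatrix_mul (p q : V) : heisMatrix (heisMul p q) = heisMatrix p * heisMatrix q := by
  ext i j
  fin_cases i <;> fin_cases j <;>
    simp [heisMatrix, heisMul, Matrix.mul_apply, Fin.sum_univ_succ] <;> ring

instance : Group Heis where
  mul := heisMul
  one := (0 : V)
  inv := heisInv
  mul_assoc p q r := by
    change heisMul (heisMul p q) r = heisMul p (heisMul q r)
    funext i; fin_cases i <;> simp [heisMul] <;> ring
  one_mul p := by
    change heisMul (0 : V) p = p
    funext i; fin_cases i <;> simp [heisMul]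
  mul_one p := by
    change heisMul p (0 : V) = p
    funext i; fin_cases i <;> simp [heisMul]
  inv_mul_cancel p := by
    change heisMul (heisInv p) p = (0 : V)
    funext i
    fin_cases i <;> simp [heisMul, heisInv]
    ring

instance : TopologicalSpace Heis := inferInstanceAs (TopologicalSpace V)

/-- The subgroup `Γ(3,1)` of the matrices with integer entries. -/
def Gamma31 : Subgroup Heis where
  carrier := {p | ∀ i j, ∃ n : ℤ, heisMatrix p i j = n}
  mul_mem' := by
    intro p q hp hq i j
    choose m hm using hp
    choose n hn using hq
    refine ⟨∑ k, m i k * n k j, ?_⟩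
    refine (congrFun (congrFun (heisMatrix_mul p q) i) j).trans ?_
    rw [Matrix.mul_apply]
    push_cast
    exact Finset.sum_congr rfl fun k _ => by rw [hm, hn]
  one_mem' := by
    intro i j
    refine ⟨(1 : Matrix (Fin 5) (Fin 5) ℤ) i j, ?_⟩
    change heisMatrix (0 : V) i j = _
    fin_cases i <;> fin_cases j <;> simp [heisMatrix]
  inv_mem' := by
    intro p hp i j
    choose m hm using hp
    refine ⟨!![1, -m 0 1, -m 0 2, -m 0 3, -m 0 4 + (m 0 1 * m 1 4 + m 0 2 * m 2 4 + m 0 3 * m 3 4);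
      0, 1, 0, 0, -m 1 4;
      0, 0, 1, 0, -m 2 4;
      0, 0, 0, 1, -m 3 4;
      0, 0, 0, 0, 1] i j, ?_⟩
    change heisMatrix (heisInv p) i j = _
    have h0 : p 0 = m 0 1 := hm 0 1
    have h1 : p 1 = m 1 4 := hm 1 4
    have h2 : p 2 = m 0 2 := hm 0 2
    have h3 : p 3 = m 2 4 := hm 2 4
    have h4 : p 4 = m 0 3 := hm 0 3
    have h5 : p 5 = m 3 4 := hm 3 4
    have h6 : p 6 = m 0 4 := hm 0 4
    fin_cases i <;> fin_cases j <;> simp [heisMatrix, heisInv, h0, h1, h2, h3, h4, h5, h6]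

/-- The nilmanifold `N(3,1) = Γ(3,1) \ H(3,1)`. -/
def N31 : Type := Quotient (QuotientGroup.rightRel Gamma31)

instance : TopologicalSpace N31 :=
  inferInstanceAs (TopologicalSpace (Quotient (QuotientGroup.rightRel Gamma31)))

/-- The projection `H(3,1) → N(3,1)`. -/
def toN31 : Heis → N31 := Quotient.mk (QuotientGroup.rightRel Gamma31)

/-- The differential form on `H(3,1)` is invariant under the left translations by `Γ(3,1)`, i.e. it
is the pull-back of a differential form on `N(3,1)`. -/
def DescendsForm {k : ℕ} (α : Form k) : Prop :=
  ∀ g ∈ Gamma31, ∀ x : V,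
    (α (heisMul g x)).compContinuousLinearMap (fderiv ℝ (heisMul g) x) = α x

/-- The function on `H(3,1)` is the pull-back of a function on `N(3,1)`. -/
def DescendsFun {S : Type*} (f : V → S) : Prop := ∀ g ∈ Gamma31, ∀ x : V, f (heisMul g x) = f x

/-- The left invariant coframe `e¹ = dx₁/a`, `e² = dy₁`, `e³ = dx₂/b`, `e⁴ = dy₂`, `e⁵ = dx₃/c`,
`e⁶ = dy₃`, `e⁷ = x₁ dy₁ + x₂ dy₂ + x₃ dy₃ - dz` on `H(3,1)`. -/
def heisCoframe (a b c : ℝ) (ha : a ≠ 0) (hb : b ≠ 0) (hc : c ≠ 0) : Coframe where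
  coframe x := LinearMap.toContinuousLinearMap
    { toFun := fun v => ![v 0 / a, v 1, v 2 / b, v 3, v 4 / c, v 5,
        x 0 * v 1 + x 2 * v 3 + x 4 * v 5 - v 6]
      map_add' := by
        intro v w
        funext i
        fin_cases i <;> simp <;> ring
      map_smul' := by
        intro r v
        funext i; fin_cases i <;> simp <;> ring }
  frame i x :=
    let u : V := Pi.single i 1
    ![a * u 0, u 1, b * u 2, u 3, c * u 4, u 5, x 0 * u 1 + x 2 * u 3 + x 4 * u 5 - u 6]
  smooth_coframe := by
    rw [contDiff_clm_apply_iff]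
    intro v
    rw [contDiff_pi]
    intro i
    fin_cases i <;> simp <;> fun_prop
  smooth_frame := by
    intro i
    rw [contDiff_pi]
    intro k
    fin_cases k <;> simp <;> fun_prop
  dual := by
    intro x i
    funext k
    fin_cases k <;> simp [ha, hb, hc]

/-- The connection `A_{λ,μ,τ}` with connection forms `σ^1_2 = -σ^2_1 = λ e⁷`,
`σ^3_4 = -σ^4_3 = μ e⁷`, `σ^5_6 = -σ^6_5 = τ e⁷` and the remaining ones zero. -/
def instantonConn (e : Coframe) (l m t : ℝ) : Conn := fun i j =>
  (l • (Matrix.single 0 1 1 - Matrix.single 1 0 1) +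
    m • (Matrix.single 2 3 1 - Matrix.single 3 2 1) +
    t • (Matrix.single 4 5 1 - Matrix.single 5 4 1) : Matrix (Fin 7) (Fin 7) ℝ) i j •
    e.form ![6]

end Heterotic

end

/-! The whole geometry is carried by one 2-form. All `e^i` with `i ≤ 6` are closed, and `ω := de^7 =
a e^12 + b e^34 + c e^56` (`blockForm a b c`, with components `blockSkew a b c`) is traceless: `a +
b + c = 0`.

Tracelessness turns `-*dΘ` into `T = ω ∧ e^7` (`heisCoframe_torsion`), so `dT = ω ∧ ω`. Adding `T/2`
to the Levi-Civita connection cancels every connection form except `-ω_ij e^7`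
(`heisCoframe_plusConn`). Hence `∇⁺` is itself the connection `A_{-a,-b,-c}`, a member of the family
that contains `A`. In this family every connection form is a multiple of `e^7`, so the quadratic
term of the curvature vanishes and the curvature is `B ⊗ ω` with `B` a constant skew matrix
(`heisCoframe_curvature_instantonConn`).

Consequently `p₁ = |B|²/(8π²) ω ∧ ω`, and the curvature square is `|B|² ∑ ω_ik ω_jk`. Since also
`Ric - H²/4 = -∑ ω_ik ω_jk` (`heisFlux_einstein`), the anomaly equation and the Einstein equation
reduce to the same scalar equation `α' (a² + b² + c² - λ² - μ² - τ²) = 4`, which is the choice of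
`α'`.

The instanton and spinor equations are again tracelessness. Contracting `ω` with `*Θ` replaces `(a,
b, c)` by `2 (b+c, a+c, a+b) = -2 (a, b, c)` (`sum_blockSkew_comp_starTheta`). The products `γ₁γ₂`,
`γ₃γ₄`, `γ₅γ₆` act on a certain plane of constant spinors by one common complex structure, so `ω`
acts there through `a + b + c = 0`; `T` and the connection forms of `∇⁺` are built from the same
matrix. -/

noncomputable section

namespace Heterotic

/-! ## Wedge products of linear functionals -/

/-- The wedge product `f₀ ∧ ⋯ ∧ f_{k-1}` of linear functionals, `v ↦ det (f_b (v_a))`. -/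
def detForm {k : ℕ} (f : Fin k → V →L[ℝ] ℝ) : V [⋀^Fin k]→L[ℝ] ℝ :=
  ContinuousMultilinearMap.alternatization
    ((ContinuousMultilinearMap.mkPiAlgebra ℝ (Fin k) ℝ).compContinuousLinearMap f)

theorem detForm_apply {k : ℕ} (f : Fin k → V →L[ℝ] ℝ) (v : Fin k → V) :
    detForm f v = (Matrix.of fun a b => f b (v a)).det := by
  rw [detForm, ContinuousMultilinearMap.alternatization_apply_apply, Matrix.det_apply]
  simp

theorem stdForm_apply {k : ℕ} (I : Fin k → Fin 7) (v : Fin k → V) :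
    stdForm I v = (Matrix.of fun a b => v a (I b)).det :=
  detForm_apply (fun a => ContinuousLinearMap.proj (I a)) v

theorem detForm_eq_zero_of_eq {k : ℕ} (f : Fin k → V →L[ℝ] ℝ) {i j : Fin k} (h : f i = f j)
    (hij : i ≠ j) : detForm f = 0 := by
  ext v
  rw [detForm_apply]
  exact Matrix.det_zero_of_column_eq hij fun a => by simp [h]

theorem detForm_comp_perm {k : ℕ} (f : Fin k → V →L[ℝ] ℝ) (σ : Equiv.Perm (Fin k)) :
    detForm (f ∘ σ) = ((Equiv.Perm.sign σ : ℤ) : ℝ) • detForm f := by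
  ext v
  rw [ContinuousAlternatingMap.smul_apply, detForm_apply, detForm_apply, smul_eq_mul,
    ← Matrix.det_permute']
  rfl

theorem wedgeAlt_apply {k l : ℕ} (α : V [⋀^Fin k]→L[ℝ] ℝ) (β : V [⋀^Fin l]→L[ℝ] ℝ)
    (v : Fin (k + l) → V) :
    wedgeAlt α β v = LinearMap.mul' ℝ ℝ (AlternatingMap.domCoprod'
      (α.toAlternatingMap ⊗ₜ[ℝ] β.toAlternatingMap) fun i => v (finSumFinEquiv i)) :=
  rfl

theorem wedgeAlt_add_left {k l : ℕ} (α α' : V [⋀^Fin k]→L[ℝ] ℝ) (β : V [⋀^Fin l]→L[ℝ] ℝ) :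
    wedgeAlt (α + α') β = wedgeAlt α β + wedgeAlt α' β := by
  ext v
  rw [ContinuousAlternatingMap.add_apply]
  simp only [wedgeAlt_apply, ContinuousAlternatingMap.toAlternatingMap_add, TensorProduct.add_tmul,
    map_add, AlternatingMap.add_apply]

theorem wedgeAlt_add_right {k l : ℕ} (α : V [⋀^Fin k]→L[ℝ] ℝ) (β β' : V [⋀^Fin l]→L[ℝ] ℝ) :
    wedgeAlt α (β + β') = wedgeAlt α β + wedgeAlt α β' := by
  ext v
  rw [ContinuousAlternatingMap.add_apply]
  simp only [wedgeAlt_apply, ContinuousAlternatingMap.toAlternatingMap_add, TensorProduct.tmul_add,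
    map_add, AlternatingMap.add_apply]

theorem wedgeAlt_smul_left {k l : ℕ} (c : ℝ) (α : V [⋀^Fin k]→L[ℝ] ℝ) (β : V [⋀^Fin l]→L[ℝ] ℝ) :
    wedgeAlt (c • α) β = c • wedgeAlt α β := by
  ext v
  rw [ContinuousAlternatingMap.smul_apply]
  simp only [wedgeAlt_apply, ContinuousAlternatingMap.toAlternatingMap_smul,
    ← TensorProduct.smul_tmul', map_smul, AlternatingMap.smul_apply]

theorem wedgeAlt_smul_right {k l : ℕ} (c : ℝ) (α : V [⋀^Fin k]→L[ℝ] ℝ) (β : V [⋀^Fin l]→L[ℝ] ℝ) :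
    wedgeAlt α (c • β) = c • wedgeAlt α β := by
  ext v
  rw [ContinuousAlternatingMap.smul_apply]
  simp only [wedgeAlt_apply, ContinuousAlternatingMap.toAlternatingMap_smul,
    TensorProduct.tmul_smul, map_smul, AlternatingMap.smul_apply]

/-- `wedge` as a bilinear map. -/
def wedgeₗ {k l : ℕ} : Form k →ₗ[ℝ] Form l →ₗ[ℝ] Form (k + l) :=
  LinearMap.mk₂ ℝ wedge
    (fun _ _ _ => funext fun _ => wedgeAlt_add_left _ _ _)
    (fun _ _ _ => funext fun _ => wedgeAlt_smul_left _ _ _)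
    (fun _ _ _ => funext fun _ => wedgeAlt_add_right _ _ _)
    (fun _ _ _ => funext fun _ => wedgeAlt_smul_right _ _ _)

theorem wedgeₗ_apply {k l : ℕ} (α : Form k) (β : Form l) : wedgeₗ α β = wedge α β := rfl

/-- The shuffle product of two alternatizations is the alternatization of the tensor product, and
for products of functionals that alternating sum is the Leibniz formula for a determinant. -/
theorem wedgeAlt_detForm {k l : ℕ} (f : Fin k → V →L[ℝ] ℝ) (g : Fin l → V →L[ℝ] ℝ) :
    wedgeAlt (detForm f) (detForm g) = detForm (Fin.append f g) := by
  ext v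
  rw [detForm_apply, wedgeAlt_apply, AlternatingMap.domCoprod'_apply]
  simp only [detForm, ContinuousMultilinearMap.alternatization_apply_toAlternatingMap]
  rw [← MultilinearMap.domCoprod_alternization, MultilinearMap.alternatization_apply, map_sum,
    ← Matrix.det_submatrix_equiv_self finSumFinEquiv, Matrix.det_apply]
  refine Finset.sum_congr rfl fun σ _ => ?_
  rw [Units.smul_def, Units.smul_def, map_zsmul, MultilinearMap.domDomCongr_apply,
    MultilinearMap.domCoprod_apply]
  simp [Fintype.prod_sum_type]

/-- Laplace expansion along the first column. This is `d(f η) = f ∧ η` for a linear function `f` and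
a constant form `η`, the only kind of differentiation needed on `H(3,1)`. -/
theorem alternatizeUncurryFin_smulRight_detForm {k : ℕ} (f : V →L[ℝ] ℝ) (g : Fin k → V →L[ℝ] ℝ) :
    ContinuousAlternatingMap.alternatizeUncurryFin (f.smulRight (detForm g)) =
      detForm (Fin.cons f g) := by
  ext v
  rw [ContinuousAlternatingMap.alternatizeUncurryFin_apply, detForm_apply,
    Matrix.det_succ_column_zero]
  refine Finset.sum_congr rfl fun i _ => ?_
  rw [ContinuousLinearMap.smulRight_apply, ContinuousAlternatingMap.smul_apply, detForm_apply]
  simp only [zsmul_eq_mul, smul_eq_mul, Int.cast_pow, Int.cast_neg, Int.cast_one, mul_assoc]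
  rfl

/-- Exhibits the last functional as an updated column, so that linearity of the determinant in one
column applies. -/
theorem snoc_matrix_eq_updateCol {k : ℕ} (g : Fin k → V →L[ℝ] ℝ) (h : V →L[ℝ] ℝ)
    (v : Fin (k + 1) → V) :
    (Matrix.of fun a b => (Fin.snoc (α := fun _ => V →L[ℝ] ℝ) g h : Fin (k + 1) → _) b (v a)) =
      (Matrix.of fun a b => (Fin.snoc (α := fun _ => V →L[ℝ] ℝ) g 0 : Fin (k + 1) → _) b
        (v a)).updateCol (Fin.last k) fun a => h (v a) := by
  ext a b
  refine Fin.lastCases ?_ (fun b => ?_) b <;> simp [Fin.castSucc_ne_last]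

theorem detForm_snoc_add {k : ℕ} (g : Fin k → V →L[ℝ] ℝ) (f f' : V →L[ℝ] ℝ) :
    detForm (Fin.snoc (α := fun _ => V →L[ℝ] ℝ) g (f + f')) =
      detForm (Fin.snoc (α := fun _ => V →L[ℝ] ℝ) g f) +
        detForm (Fin.snoc (α := fun _ => V →L[ℝ] ℝ) g f') := by
  ext v
  rw [ContinuousAlternatingMap.add_apply, detForm_apply, detForm_apply, detForm_apply,
    snoc_matrix_eq_updateCol g f,
    snoc_matrix_eq_updateCol g f', snoc_matrix_eq_updateCol g (f + f'), ← Matrix.det_updateCol_add]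
  rfl

theorem detForm_snoc_smul {k : ℕ} (g : Fin k → V →L[ℝ] ℝ) (c : ℝ) (f : V →L[ℝ] ℝ) :
    detForm (Fin.snoc (α := fun _ => V →L[ℝ] ℝ) g (c • f)) =
      c • detForm (Fin.snoc (α := fun _ => V →L[ℝ] ℝ) g f) := by
  ext v
  rw [ContinuousAlternatingMap.smul_apply, detForm_apply, detForm_apply,
    snoc_matrix_eq_updateCol g f,
    snoc_matrix_eq_updateCol g (c • f), smul_eq_mul, ← Matrix.det_updateCol_smul]
  rfl

/-! ## Forms with constant coefficients in a coframe -/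

namespace Coframe

variable (e : Coframe)

/-- The value at `x` of the coframe element with index `i`. -/
def covec (x : V) (i : Fin 7) : V →L[ℝ] ℝ := (ContinuousLinearMap.proj i).comp (e.coframe x)

theorem covec_apply (x : V) (i : Fin 7) (v : V) : e.covec x i v = e.coframe x v i := rfl

theorem form_eq_detForm {k : ℕ} (I : Fin k → Fin 7) (x : V) :
    e.form I x = detForm fun a => e.covec x (I a) := by
  ext v
  rw [detForm_apply]
  exact stdForm_apply I _

theorem form_apply {k : ℕ} (I : Fin k → Fin 7) (x : V) (v : Fin k → V) :
    e.form I x v = (Matrix.of fun a b => e.coframe x (v a) (I b)).det :=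
  stdForm_apply I _

theorem comp_form {k : ℕ} (I J : Fin k → Fin 7) (x : V) :
    e.comp (e.form I) x J = (Matrix.of fun a b => if I b = J a then (1 : ℝ) else 0).det := by
  rw [comp, form_apply]
  congr 2
  ext a b
  rw [e.dual, Pi.single_apply]

theorem form_eq_zero_of_eq {k : ℕ} (I : Fin k → Fin 7) (i j : Fin k) (h : I i = I j)
    (hij : i ≠ j) : e.form I = 0 := by
  funext x
  rw [form_eq_detForm]
  exact detForm_eq_zero_of_eq _ (by rw [h]) hij

theorem form_comp_perm {k : ℕ} (I : Fin k → Fin 7) (σ : Equiv.Perm (Fin k)) :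
    e.form (I ∘ σ) = ((Equiv.Perm.sign σ : ℤ) : ℝ) • e.form I := by
  funext x
  rw [Pi.smul_apply, form_eq_detForm, form_eq_detForm, ← detForm_comp_perm]
  rfl

theorem wedge_form {k l : ℕ} (I : Fin k → Fin 7) (J : Fin l → Fin 7) :
    wedge (e.form I) (e.form J) = e.form (Fin.append I J) := by
  funext x
  rw [wedge, form_eq_detForm, form_eq_detForm, wedgeAlt_detForm, form_eq_detForm]
  congr 1
  funext a
  refine Fin.addCases (fun i => ?_) (fun i => ?_) a <;> simp

/-- The frame spans, so alternating forms are determined by their components. -/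
theorem sum_coframe_smul_frame (x v : V) : ∑ i, e.coframe x v i • e.frame i x = v := by
  have hs : Function.Surjective (e.coframe x : V →ₗ[ℝ] V) := by
    intro w
    refine ⟨∑ i, w i • e.frame i x, ?_⟩
    simp only [map_sum, map_smul, ContinuousLinearMap.coe_coe, e.dual]
    funext j
    simp [Finset.sum_apply, Pi.single_apply]
  have hi : Function.Injective (e.coframe x : V →ₗ[ℝ] V) :=
    LinearMap.injective_iff_surjective.2 hs
  refine hi ?_
  simp only [map_sum, map_smul, ContinuousLinearMap.coe_coe, e.dual]
  funext j
  simp [Finset.sum_apply, Pi.single_apply]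

theorem form_one_apply (i : Fin 7) (x : V) (v : Fin 1 → V) :
    e.form ![i] x v = e.coframe x (v 0) i := by
  simp [form_apply]

theorem comp_form_one (i j : Fin 7) (x : V) :
    e.comp (e.form ![i]) x ![j] = if i = j then 1 else 0 := by
  simp [comp_form]

theorem comp_form_two (i j k l : Fin 7) (x : V) :
    e.comp (e.form ![i, j]) x ![k, l] =
      (if i = k then 1 else 0) * (if j = l then 1 else 0) -
        (if j = k then 1 else 0) * (if i = l then 1 else 0) := by
  rw [comp_form, Matrix.det_fin_two]
  simp only [Matrix.of_apply, Matrix.cons_val_zero, Matrix.cons_val_one]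
  rfl

theorem oneForm_eq_sum (α : Form 1) (x : V) :
    α x = ∑ k, e.comp α x ![k] • e.form ![k] x := by
  ext v
  have hv : v = ![v 0] := by funext i; fin_cases i; rfl
  rw [ContinuousAlternatingMap.sum_apply]
  simp only [ContinuousAlternatingMap.smul_apply, form_one_apply, smul_eq_mul]
  -- Repackaging the 1-form as a linear functional lets it be evaluated on the frame expansion of `v
  -- 0`.
  obtain ⟨L, hL⟩ : ∃ L : V →ₗ[ℝ] ℝ, ∀ w, α x ![w] = L w := by
    have hu (w : V) : Function.update ![(0 : V)] 0 w = ![w] := by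
      funext i; fin_cases i; simp
    refine ⟨⟨⟨fun w => α x ![w], fun w w' => ?_⟩, fun c w => ?_⟩, fun w => rfl⟩
    · have := (α x).map_update_add ![0] 0 w w'
      rwa [hu, hu, hu] at this
    · have := (α x).map_update_smul ![0] 0 c w
      rwa [hu, hu] at this
  rw [hv, hL]
  conv_lhs => rw [← e.sum_coframe_smul_frame x (v 0)]
  rw [map_sum]
  refine Finset.sum_congr rfl fun k _ => ?_
  rw [map_smul, smul_eq_mul, mul_comm, ← hL, comp]
  congr 2
  funext a
  fin_cases a
  rfl

end Coframe

theorem neg_one_smul_form {k : ℕ} (α : Form k) : (-1 : ℝ) • α = -α := by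
  funext x
  ext v
  exact neg_one_mul (α x v)

/-! ## The Hodge star on the forms `e^I` -/

theorem injective_of_leviCivitaSymbol_ne_zero {n : ℕ} {f : Fin n → Fin n}
    (h : leviCivitaSymbol f ≠ 0) : Function.Injective f := by
  have key (p q : Fin n) (hpq : p < q) : f p ≠ f q := by
    intro hf
    refine h (Finset.prod_eq_zero (Finset.mem_univ p)
      (Finset.prod_eq_zero (Finset.mem_Ioi.2 hpq) ?_))
    rw [hf, sub_self, Int.sign_zero]
  intro p q hf
  by_contra hne
  rcases lt_or_gt_of_ne hne with h' | h'
  · exact key p q h' hf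
  · exact key q p h' hf.symm

/-- Two increasing multi-indices of length `l` that complement the same multi-index are equal. -/
theorem eq_of_injective_append {k l : ℕ} (h : k + l = 7) (I : Fin k ↪o Fin 7)
    (J J' : Fin l ↪o Fin 7)
    (hJ : Function.Injective fun p : Fin 7 => Fin.append I J (Fin.cast h.symm p))
    (hJ' : Function.Injective fun p : Fin 7 => Fin.append I J' (Fin.cast h.symm p)) : J = J' := by
  -- An injective self-map of `Fin 7` is onto, so `K` enumerates exactly the complement of `I`; an
  -- increasing enumeration is determined by its range.
  have key (K : Fin l ↪o Fin 7)
      (hK : Function.Injective fun p : Fin 7 => Fin.append I K (Fin.cast h.symm p)) :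
      Set.range K = (Set.range I)ᶜ := by
    have hs := Finite.injective_iff_surjective.1 hK
    ext y
    constructor
    · rintro ⟨j, rfl⟩ ⟨i, hi⟩
      have := @hK (Fin.cast h (Fin.castAdd l i)) (Fin.cast h (Fin.natAdd k j)) (by simpa using hi)
      have := congrArg Fin.val this
      simp at this
      omega
    · intro hy
      obtain ⟨p, hp⟩ := hs y
      dsimp only at hp
      generalize Fin.cast h.symm p = q at hp
      revert hp
      refine Fin.addCases (fun i => ?_) (fun j => ?_) q
      · intro hp
        exact (hy ⟨i, by simpa using hp⟩).elim
      · intro hp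
        exact ⟨j, by simpa using hp⟩
  exact OrderEmbedding.range_inj.1 ((key J hJ).trans (key J' hJ').symm)

namespace Coframe

variable (e : Coframe)

theorem comp_add {k : ℕ} (α β : Form k) (x : V) (I : Fin k → Fin 7) :
    e.comp (α + β) x I = e.comp α x I + e.comp β x I := rfl

theorem comp_smul {k : ℕ} (c : ℝ) (α : Form k) (x : V) (I : Fin k → Fin 7) :
    e.comp (c • α) x I = c * e.comp α x I := rfl

theorem comp_sub {k : ℕ} (α β : Form k) (x : V) (I : Fin k → Fin 7) :
    e.comp (α - β) x I = e.comp α x I - e.comp β x I := rfl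

theorem hodge_add {k l : ℕ} (h : k + l = 7) (α β : Form k) :
    e.hodge h (α + β) = e.hodge h α + e.hodge h β := by
  funext x
  simp only [hodge, Pi.add_apply, comp_add, mul_add, add_smul, Finset.sum_add_distrib]

theorem hodge_smul {k l : ℕ} (h : k + l = 7) (c : ℝ) (α : Form k) :
    e.hodge h (c • α) = c • e.hodge h α := by
  funext x
  simp only [hodge, Pi.smul_apply, comp_smul, mul_left_comm _ c, mul_smul, Finset.smul_sum]

theorem hodge_neg {k l : ℕ} (h : k + l = 7) (α : Form k) :
    e.hodge h (-α) = -e.hodge h α := by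
  rw [← neg_one_smul_form α, hodge_smul, neg_one_smul_form]

theorem hodge_sub {k l : ℕ} (h : k + l = 7) (α β : Form k) :
    e.hodge h (α - β) = e.hodge h α - e.hodge h β := by
  rw [sub_eq_add_neg, hodge_add, hodge_neg, ← sub_eq_add_neg]

/-- If `I ≠ J`, equality of cardinalities forces some `J a` outside the range of `I`, and the
corresponding row of the 0-1 matrix is zero. -/
theorem comp_form_orderEmbedding {k : ℕ} (I J : Fin k ↪o Fin 7) (x : V) :
    e.comp (e.form I) x J = if I = J then 1 else 0 := by
  rw [comp_form]
  split_ifs with h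
  · subst h
    rw [← Matrix.det_one (n := Fin k)]
    congr 1
    ext a b
    simp [Matrix.one_apply, eq_comm]
  · have : ∃ a, J a ∉ Set.range I := by
      by_contra! hc
      refine h (OrderEmbedding.range_inj.1 ?_)
      have hsub : Finset.univ.map J.toEmbedding ⊆ Finset.univ.map I.toEmbedding := by
        intro y hy
        obtain ⟨a, -, rfl⟩ := Finset.mem_map.1 hy
        obtain ⟨b, hb⟩ := hc a
        exact Finset.mem_map.2 ⟨b, Finset.mem_univ b, hb⟩
      have := Finset.eq_of_subset_of_card_le hsub (by simp)
      have := congrArg (fun s : Finset (Fin 7) => (s : Set (Fin 7))) this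
      simpa using this.symm
    obtain ⟨a, ha⟩ := this
    refine Matrix.det_eq_zero_of_row_eq_zero a fun b => ?_
    rw [Matrix.of_apply, if_neg fun hb => ha ⟨b, hb⟩]

/-- The component factor selects `I`, and a nonzero Levi-Civita symbol selects its complement, so
one term of the double sum survives. Taking the sign `ε` as an argument makes each instance
checkable by `decide`. -/
theorem hodge_form {k l : ℕ} (h : k + l = 7) {I : Fin k → Fin 7} (hI : StrictMono I)
    {J : Fin l → Fin 7} (hJ : StrictMono J) (ε : ℤ) (hε₀ : ε ≠ 0)
    (hε : leviCivitaSymbol (fun p : Fin 7 => Fin.append I J (Fin.cast h.symm p)) = ε) :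
    e.hodge h (e.form I) = (ε : ℝ) • e.form J := by
  obtain ⟨I, rfl⟩ : ∃ I' : Fin k ↪o Fin 7, I = I' := ⟨OrderEmbedding.ofStrictMono I hI, rfl⟩
  obtain ⟨J, rfl⟩ : ∃ J' : Fin l ↪o Fin 7, J = J' := ⟨OrderEmbedding.ofStrictMono J hJ, rfl⟩
  funext x
  rw [hodge, Finset.sum_eq_single I, Finset.sum_eq_single J]
  · rw [comp_form_orderEmbedding, if_pos rfl, mul_one, hε, Pi.smul_apply]
  · intro J' _ hne
    rw [comp_form_orderEmbedding, if_pos rfl, mul_one]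
    by_cases hz : leviCivitaSymbol (fun p : Fin 7 => Fin.append I J' (Fin.cast h.symm p)) = 0
    · rw [hz, Int.cast_zero, zero_smul]
    · exact (hne (eq_of_injective_append h I J' J (injective_of_leviCivitaSymbol_ne_zero hz)
        (injective_of_leviCivitaSymbol_ne_zero (hε ▸ hε₀)))).elim
  · simp
  · intro I' _ hne
    refine Finset.sum_eq_zero fun J' _ => ?_
    rw [comp_form_orderEmbedding, if_neg hne.symm, mul_zero, zero_smul]
  · simp

theorem starTheta_eq : e.starTheta =
    e.form ![2, 3, 4, 5] + e.form ![0, 3, 4, 6] + e.form ![0, 1, 4, 5] + e.form ![0, 1, 2, 3]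
      + e.form ![1, 2, 4, 6] + e.form ![0, 2, 5, 6] - e.form ![1, 3, 5, 6] := by
  rw [starTheta, theta, hodge_add, hodge_sub, hodge_sub, hodge_add, hodge_add, hodge_sub,
    e.hodge_form rfl (I := ![0, 1, 6]) (J := ![2, 3, 4, 5]) (by decide) (by decide) 1 (by decide)
      (by decide),
    e.hodge_form rfl (I := ![1, 2, 5]) (J := ![0, 3, 4, 6]) (by decide) (by decide) (-1) (by decide)
      (by decide),
    e.hodge_form rfl (I := ![2, 3, 6]) (J := ![0, 1, 4, 5]) (by decide) (by decide) 1 (by decide)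
      (by decide),
    e.hodge_form rfl (I := ![4, 5, 6]) (J := ![0, 1, 2, 3]) (by decide) (by decide) 1 (by decide)
      (by decide),
    e.hodge_form rfl (I := ![0, 3, 5]) (J := ![1, 2, 4, 6]) (by decide) (by decide) (-1) (by decide)
      (by decide),
    e.hodge_form rfl (I := ![1, 3, 4]) (J := ![0, 2, 5, 6]) (by decide) (by decide) (-1) (by decide)
      (by decide),
    e.hodge_form rfl (I := ![0, 2, 4]) (J := ![1, 3, 5, 6]) (by decide) (by decide) (-1) (by decide)
      (by decide)]
  simp only [Int.cast_one, Int.cast_neg, one_smul, neg_one_smul_form]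
  abel

end Coframe

/-! ### Wedge products of the forms `e^I` -/

namespace Coframe

variable (e : Coframe)

theorem differentiable_form {k : ℕ} (I : Fin k → Fin 7) : Differentiable ℝ (e.form I) := by
  intro x
  have h := (e.smooth_coframe.differentiable (by simp)) x
  exact (differentiableAt_const (stdForm I)).continuousAlternatingMapCompContinuousLinearMap h

theorem wedge_form_eq_zero {k l : ℕ} (I : Fin k → Fin 7) (J : Fin l → Fin 7)
    (h : ∃ i j, I i = J j) : wedge (e.form I) (e.form J) = 0 := by
  obtain ⟨i, j, hij⟩ := h
  rw [wedge_form]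
  refine e.form_eq_zero_of_eq _ (Fin.castAdd l i) (Fin.natAdd k j) (by simpa using hij) ?_
  intro hc
  have := congrArg Fin.val hc
  simp at this
  omega

/-- A 3-cycle is a product of two transpositions, hence even. These rotations bring the terms of
`d(e^{ij7})` into increasing order without signs. -/
theorem form_rotate_init (i j k l : Fin 7) : e.form ![k, i, j, l] = e.form ![i, j, k, l] := by
  have h := e.form_comp_perm ![i, j, k, l] (Equiv.swap 0 1 * Equiv.swap 0 2 : Equiv.Perm (Fin 4))
  rw [Equiv.Perm.sign_mul, Equiv.Perm.sign_swap (by decide), Equiv.Perm.sign_swap (by decide)] at h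
  have hp : ![i, j, k, l] ∘ ⇑(Equiv.swap 0 1 * Equiv.swap 0 2 : Equiv.Perm (Fin 4)) =
      ![k, i, j, l] := by
    funext a; fin_cases a <;> rfl
  rw [← hp, h]
  simp

theorem form_rotate_tail (i j k l : Fin 7) : e.form ![i, k, l, j] = e.form ![i, j, k, l] := by
  have h := e.form_comp_perm ![i, j, k, l] (Equiv.swap 1 2 * Equiv.swap 2 3 : Equiv.Perm (Fin 4))
  rw [Equiv.Perm.sign_mul, Equiv.Perm.sign_swap (by decide), Equiv.Perm.sign_swap (by decide)] at h
  have hp : ![i, j, k, l] ∘ ⇑(Equiv.swap 1 2 * Equiv.swap 2 3 : Equiv.Perm (Fin 4)) =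
      ![i, k, l, j] := by
    funext a; fin_cases a <;> rfl
  rw [← hp, h]
  simp

theorem form_swap_pairs (i j k l : Fin 7) : e.form ![k, l, i, j] = e.form ![i, j, k, l] := by
  rw [form_rotate_init e l i k j, form_rotate_init e i k l j, form_rotate_tail]

/-- The `2`-form `p e¹² + q e³⁴ + r e⁵⁶`. -/
def blockForm (p q r : ℝ) : Form 2 :=
  p • e.form ![0, 1] + q • e.form ![2, 3] + r • e.form ![4, 5]

theorem wedge_blockForm (p q r p' q' r' : ℝ) :
    wedge (e.blockForm p q r) (e.blockForm p' q' r') =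
      (p * q' + q * p') • e.form ![0, 1, 2, 3] + (p * r' + r * p') • e.form ![0, 1, 4, 5] +
        (q * r' + r * q') • e.form ![2, 3, 4, 5] := by
  have h1 : wedge (e.form ![2, 3]) (e.form ![0, 1]) = e.form ![0, 1, 2, 3] := by
    rw [wedge_form]; exact e.form_swap_pairs 0 1 2 3
  have h2 : wedge (e.form ![4, 5]) (e.form ![0, 1]) = e.form ![0, 1, 4, 5] := by
    rw [wedge_form]; exact e.form_swap_pairs 0 1 4 5
  have h3 : wedge (e.form ![4, 5]) (e.form ![2, 3]) = e.form ![2, 3, 4, 5] := by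
    rw [wedge_form]; exact e.form_swap_pairs 2 3 4 5
  have h4 : wedge (e.form ![0, 1]) (e.form ![2, 3]) = e.form ![0, 1, 2, 3] := wedge_form _ _ _
  have h5 : wedge (e.form ![0, 1]) (e.form ![4, 5]) = e.form ![0, 1, 4, 5] := wedge_form _ _ _
  have h6 : wedge (e.form ![2, 3]) (e.form ![4, 5]) = e.form ![2, 3, 4, 5] := wedge_form _ _ _
  rw [← wedgeₗ_apply]
  simp only [blockForm, map_add, map_smul, LinearMap.add_apply, LinearMap.smul_apply, wedgeₗ_apply,
    h1, h2, h3, h4, h5, h6, e.wedge_form_eq_zero ![0, 1] ![0, 1] (by decide),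
    e.wedge_form_eq_zero ![2, 3] ![2, 3] (by decide),
    e.wedge_form_eq_zero ![4, 5] ![4, 5] (by decide)]
  module

end Coframe

theorem extDeriv_add_form {k : ℕ} {α β : Form k} (hα : Differentiable ℝ α)
    (hβ : Differentiable ℝ β) : extDeriv (α + β) = extDeriv α + extDeriv β :=
  funext fun x => extDeriv_add (hα x) (hβ x)

theorem extDeriv_smul_form {k : ℕ} (c : ℝ) (α : Form k) :
    extDeriv (c • α) = c • extDeriv α :=
  funext fun _ => extDeriv_smul c α

theorem extDeriv_neg_form {k : ℕ} (α : Form k) : extDeriv (-α) = -extDeriv α := by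
  rw [← neg_one_smul_form, extDeriv_smul_form, neg_one_smul_form]

theorem extDeriv_sub_form {k : ℕ} {α β : Form k} (hα : Differentiable ℝ α)
    (hβ : Differentiable ℝ β) : extDeriv (α - β) = extDeriv α - extDeriv β := by
  rw [sub_eq_add_neg, extDeriv_add_form hα hβ.neg, extDeriv_neg_form, ← sub_eq_add_neg]

/-! ## Exterior derivatives on `H(3,1)` -/

section Heisenberg

variable (a b c : ℝ) (ha : a ≠ 0) (hb : b ≠ 0) (hc : c ≠ 0)

theorem heisCoframe_coframe_apply (x v : V) :
    (heisCoframe a b c ha hb hc).coframe x v = ![v 0 / a, v 1, v 2 / b, v 3, v 4 / c, v 5,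
        x 0 * v 1 + x 2 * v 3 + x 4 * v 5 - v 6] := rfl

theorem heisCoframe_covec_of_ne (x : V) {i : Fin 7} (hi : i ≠ 6) :
    (heisCoframe a b c ha hb hc).covec x i = (heisCoframe a b c ha hb hc).covec 0 i := by
  ext1 v
  rw [Coframe.covec_apply, Coframe.covec_apply, heisCoframe_coframe_apply,
    heisCoframe_coframe_apply]
  fin_cases i <;> simp at hi ⊢

/-- Expanding in the coframe frozen at the origin isolates all dependence on the base point in three
linear coefficients. -/
theorem heisCoframe_covec_six (x : V) :
    (heisCoframe a b c ha hb hc).covec x 6 =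
      x 0 • (heisCoframe a b c ha hb hc).covec 0 1 + x 2 • (heisCoframe a b c ha hb hc).covec 0 3 +
        x 4 • (heisCoframe a b c ha hb hc).covec 0 5 +
          (heisCoframe a b c ha hb hc).covec 0 6 := by
  ext1 v
  simp [Coframe.covec_apply, heisCoframe_coframe_apply]
  ring

theorem heisCoframe_form_eq_const {k : ℕ} (I : Fin k → Fin 7) (hI : ∀ i, I i ≠ 6) (x : V) :
    (heisCoframe a b c ha hb hc).form I x = (heisCoframe a b c ha hb hc).form I 0 := by
  rw [Coframe.form_eq_detForm, Coframe.form_eq_detForm]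
  congr 1
  funext i
  exact heisCoframe_covec_of_ne a b c ha hb hc x (hI i)

theorem heisCoframe_extDeriv_form_of_ne {k : ℕ} (I : Fin k → Fin 7) (hI : ∀ i, I i ≠ 6) :
    extDeriv ((heisCoframe a b c ha hb hc).form I) = 0 := by
  funext x
  have : (heisCoframe a b c ha hb hc).form I = fun _ => (heisCoframe a b c ha hb hc).form I 0 :=
    funext fun y => heisCoframe_form_eq_const a b c ha hb hc I hI y
  rw [this, extDeriv, fderiv_fun_const]
  exact (ContinuousAlternatingMap.alternatizeUncurryFinCLM ℝ V ℝ).map_zero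

theorem alternatizeUncurryFin_smul_smulRight_detForm {k : ℕ} (r : ℝ) (f : V →L[ℝ] ℝ)
    (g : Fin k → V →L[ℝ] ℝ) :
    ContinuousAlternatingMap.alternatizeUncurryFin ((r • f).smulRight (detForm g)) =
      r • detForm (Fin.cons f g) := by
  rw [← alternatizeUncurryFin_smulRight_detForm,
    ← ContinuousAlternatingMap.alternatizeUncurryFin_smul]
  congr 1
  ext1 v
  simp [mul_smul]

/-- With `e^J` constant, `e^J ∧ e^7` is affine in `x₁, x₂, x₃`; differentiating a coefficient `x₁`
puts `dx₁ = a e^1` in front, and similarly for the other two. Leaving this factor in front avoids a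
sign depending on `k`. -/
theorem heisCoframe_extDeriv_form_snoc {k : ℕ} (J : Fin k → Fin 7) (hJ : ∀ i, J i ≠ 6) :
    extDeriv ((heisCoframe a b c ha hb hc).form (Fin.snoc (α := fun _ => Fin 7) J 6)) =
      a • (heisCoframe a b c ha hb hc).form
          (Fin.cons (α := fun _ => Fin 7) 0 (Fin.snoc (α := fun _ => Fin 7) J 1)) +
      b • (heisCoframe a b c ha hb hc).form
          (Fin.cons (α := fun _ => Fin 7) 2 (Fin.snoc (α := fun _ => Fin 7) J 3)) +
      c • (heisCoframe a b c ha hb hc).form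
          (Fin.cons (α := fun _ => Fin 7) 4 (Fin.snoc (α := fun _ => Fin 7) J 5)) := by
  set e := heisCoframe a b c ha hb hc with he
  set G : Fin 7 → Fin (k + 1) → V →L[ℝ] ℝ := fun i =>
    Fin.snoc (α := fun _ => V →L[ℝ] ℝ) (fun j => e.covec 0 (J j)) (e.covec 0 i) with hG
  have hform : e.form (Fin.snoc (α := fun _ => Fin 7) J 6) = fun x =>
      x 0 • detForm (G 1) + x 2 • detForm (G 3) + x 4 • detForm (G 5) + detForm (G 6) := by
    funext x
    rw [Coframe.form_eq_detForm]
    have : (fun i => e.covec x (Fin.snoc (α := fun _ => Fin 7) J 6 i)) =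
        Fin.snoc (α := fun _ => V →L[ℝ] ℝ) (fun j => e.covec 0 (J j)) (e.covec x 6) := by
      funext i
      refine Fin.lastCases ?_ (fun j => ?_) i
      · simp
      · simp only [Fin.snoc_castSucc]
        exact heisCoframe_covec_of_ne a b c ha hb hc x (hJ j)
    rw [this, heisCoframe_covec_six, detForm_snoc_add, detForm_snoc_add, detForm_snoc_add,
      detForm_snoc_smul, detForm_snoc_smul, detForm_snoc_smul]
  -- The derivative is computed in the coframe at the origin; since none of its indices is `6`, it
  -- can be rewritten in the coframe at `x`.
  have hp (r : ℝ) (i j m : Fin 7) (hj : j ≠ 6) (hm : m ≠ 6)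
      (h : (ContinuousLinearMap.proj i : V →L[ℝ] ℝ) = r • e.covec 0 j) (x : V) :
      ContinuousAlternatingMap.alternatizeUncurryFin
        ((ContinuousLinearMap.proj i : V →L[ℝ] ℝ).smulRight (detForm (G m))) =
      r • e.form (Fin.cons (α := fun _ => Fin 7) j (Fin.snoc (α := fun _ => Fin 7) J m)) x := by
    rw [h, alternatizeUncurryFin_smul_smulRight_detForm, Coframe.form_eq_detForm]
    congr 2
    funext s
    refine Fin.cases ?_ (fun s => ?_) s
    · exact (heisCoframe_covec_of_ne a b c ha hb hc x hj).symm
    · refine Fin.lastCases ?_ (fun s => ?_) s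
      · simp [hG]
        exact (heisCoframe_covec_of_ne a b c ha hb hc x hm).symm
      · simp [hG]
        exact (heisCoframe_covec_of_ne a b c ha hb hc x (hJ s)).symm
  funext x
  have hd : HasFDerivAt (e.form (Fin.snoc (α := fun _ => Fin 7) J 6))
      ((ContinuousLinearMap.proj 0 : V →L[ℝ] ℝ).smulRight (detForm (G 1)) +
        (ContinuousLinearMap.proj 2 : V →L[ℝ] ℝ).smulRight (detForm (G 3)) +
        (ContinuousLinearMap.proj 4 : V →L[ℝ] ℝ).smulRight (detForm (G 5))) x := by
    rw [hform]
    have h (i : Fin 7) (η : V [⋀^Fin (k + 1)]→L[ℝ] ℝ) :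
        HasFDerivAt (fun x : V => x i • η) ((ContinuousLinearMap.proj i : V →L[ℝ] ℝ).smulRight η)
          x :=
      ((ContinuousLinearMap.proj i : V →L[ℝ] ℝ).smulRight η).hasFDerivAt
    exact (((h 0 _).add (h 2 _)).add (h 4 _)).add_const _
  rw [extDeriv, hd.fderiv, ContinuousAlternatingMap.alternatizeUncurryFin_add,
    ContinuousAlternatingMap.alternatizeUncurryFin_add,
    hp a 0 0 1 (by decide) (by decide) ?_ x, hp b 2 2 3 (by decide) (by decide) ?_ x,
    hp c 4 4 5 (by decide) (by decide) ?_ x]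
  · rfl
  · ext1 v
    simp [Coframe.covec_apply, he, heisCoframe_coframe_apply]
    field_simp
  · ext1 v
    simp [Coframe.covec_apply, he, heisCoframe_coframe_apply]
    field_simp
  · ext1 v
    simp [Coframe.covec_apply, he, heisCoframe_coframe_apply]
    field_simp

theorem heisCoframe_extDeriv_form_six :
    extDeriv ((heisCoframe a b c ha hb hc).form ![6]) =
      (heisCoframe a b c ha hb hc).blockForm a b c := by
  have h := heisCoframe_extDeriv_form_snoc a b c ha hb hc ![] (fun i => i.elim0)
  have hs (k : Fin 7) : Fin.snoc (α := fun _ => Fin 7) ![] k = ![k] := by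
    funext s; fin_cases s; rfl
  rw [hs, hs, hs, hs] at h
  rw [Coframe.blockForm]
  exact h

theorem heisCoframe_extDeriv_form_one (i : Fin 7) :
    extDeriv ((heisCoframe a b c ha hb hc).form ![i]) =
      (if i = 6 then 1 else 0 : ℝ) • (heisCoframe a b c ha hb hc).blockForm a b c := by
  split_ifs with h
  · rw [h, heisCoframe_extDeriv_form_six, one_smul]
  · rw [zero_smul]
    exact heisCoframe_extDeriv_form_of_ne a b c ha hb hc _ fun j => by fin_cases j; exact h

theorem heisCoframe_extDeriv_form_three (i j : Fin 7) (hi : i ≠ 6) (hj : j ≠ 6) :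
    extDeriv ((heisCoframe a b c ha hb hc).form ![i, j, 6]) =
      a • (heisCoframe a b c ha hb hc).form ![0, i, j, 1] +
      b • (heisCoframe a b c ha hb hc).form ![2, i, j, 3] +
      c • (heisCoframe a b c ha hb hc).form ![4, i, j, 5] := by
  have h := heisCoframe_extDeriv_form_snoc a b c ha hb hc ![i, j]
    (fun k => by fin_cases k <;> assumption)
  have hs (k : Fin 7) : Fin.snoc (α := fun _ => Fin 7) ![i, j] k = ![i, j, k] := by
    funext s; fin_cases s <;> rfl
  have hcons (l m : Fin 7) : Fin.cons (α := fun _ => Fin 7) l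
      (Fin.snoc (α := fun _ => Fin 7) ![i, j] m) = ![l, i, j, m] := by
    funext s; fin_cases s <;> rfl
  rw [hs, hcons, hcons, hcons] at h
  exact h

set_option maxRecDepth 4000 in
theorem heisCoframe_extDeriv_form_four (i j k : Fin 7) (hi : i ≠ 6) (hj : j ≠ 6) (hk : k ≠ 6) :
    extDeriv ((heisCoframe a b c ha hb hc).form ![i, j, k, 6]) =
      a • (heisCoframe a b c ha hb hc).form ![0, i, j, k, 1] +
      b • (heisCoframe a b c ha hb hc).form ![2, i, j, k, 3] +
      c • (heisCoframe a b c ha hb hc).form ![4, i, j, k, 5] := by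
  have h := heisCoframe_extDeriv_form_snoc a b c ha hb hc ![i, j, k]
    (fun k => by fin_cases k <;> assumption)
  have hs (l : Fin 7) : Fin.snoc (α := fun _ => Fin 7) ![i, j, k] l = ![i, j, k, l] := by
    funext s; fin_cases s <;> rfl
  have hcons (l m : Fin 7) : Fin.cons (α := fun _ => Fin 7) l
      (Fin.snoc (α := fun _ => Fin 7) ![i, j, k] m) = ![l, i, j, k, m] := by
    funext s; fin_cases s <;> rfl
  rw [hs, hcons, hcons, hcons] at h
  exact h

end Heisenberg

/-- The skew matrix of the `2`-form `p e¹² + q e³⁴ + r e⁵⁶`. -/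
def blockSkew (p q r : ℝ) : Matrix (Fin 7) (Fin 7) ℝ :=
  !![0, p, 0, 0, 0, 0, 0;
     -p, 0, 0, 0, 0, 0, 0;
     0, 0, 0, q, 0, 0, 0;
     0, 0, -q, 0, 0, 0, 0;
     0, 0, 0, 0, 0, r, 0;
     0, 0, 0, 0, -r, 0, 0;
     0, 0, 0, 0, 0, 0, 0]

theorem blockSkew_neg (p q r : ℝ) (i j : Fin 7) :
    blockSkew (-p) (-q) (-r) i j = -blockSkew p q r i j := by
  fin_cases i <;> fin_cases j <;> simp [blockSkew]

theorem blockSkew_swap (p q r : ℝ) (i j : Fin 7) :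
    blockSkew p q r j i = -blockSkew p q r i j := by
  fin_cases i <;> fin_cases j <;> simp [blockSkew]

theorem sum_blockSkew_sq (p q r : ℝ) :
    ∑ i, ∑ j ∈ Finset.Ioi i, blockSkew p q r i j * blockSkew p q r i j =
      p ^ 2 + q ^ 2 + r ^ 2 := by
  have h (i : Fin 7) : Finset.Ioi i = Finset.univ.filter (i < ·) := by ext; simp
  simp only [h, Finset.sum_filter, Fin.sum_univ_seven]
  simp [blockSkew]
  ring

theorem instantonConn_apply (e : Coframe) (l m t : ℝ) (i j : Fin 7) :
    instantonConn e l m t i j = blockSkew l m t i j • e.form ![6] := by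
  rw [instantonConn]
  congr 1
  fin_cases i <;> fin_cases j <;> simp [blockSkew, Matrix.single]

/-! ### Components in the frame -/

namespace Coframe

variable (e : Coframe)

theorem comp_blockForm (p q r : ℝ) (i j : Fin 7) (x : V) :
    e.comp (e.blockForm p q r) x ![i, j] = blockSkew p q r i j := by
  rw [blockForm, comp_add, comp_add, comp_smul, comp_smul, comp_smul, comp_form_two, comp_form_two,
    comp_form_two]
  fin_cases i <;> fin_cases j <;> simp [blockSkew]

theorem comp_form_three (p q r i j k : Fin 7) (x : V) :
    e.comp (e.form ![p, q, r]) x ![i, j, k] =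
      e.comp (e.form ![p, q]) x ![i, j] * (if r = k then 1 else 0) +
      e.comp (e.form ![p, q]) x ![j, k] * (if r = i then 1 else 0) +
      e.comp (e.form ![p, q]) x ![k, i] * (if r = j then 1 else 0) := by
  rw [← comp_form_one e r k x, ← comp_form_one e r i x, ← comp_form_one e r j x]
  simp only [comp, form_apply, Matrix.det_fin_three, Matrix.det_fin_two, Matrix.det_fin_one,
    Matrix.of_apply, Matrix.cons_val_zero, Matrix.cons_val_one, Matrix.cons_val]
  ring

/-- Pointwise every 1-form is a linear functional, so wedge products of connection forms fall under
`wedgeAlt_detForm`. -/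
theorem exists_oneForm_eq_detForm (α : Form 1) (x : V) :
    ∃ L : V →L[ℝ] ℝ, α x = detForm ![L] ∧ ∀ i, L (e.frame i x) = e.comp α x ![i] := by
  refine ⟨∑ k, e.comp α x ![k] • e.covec x k, ?_, fun i => ?_⟩
  · rw [e.oneForm_eq_sum α x]
    ext v
    rw [detForm_apply, ContinuousAlternatingMap.sum_apply]
    simp [form_one_apply, covec_apply]
  · simp [covec_apply, e.dual, Pi.single_apply]

theorem comp_wedge_one_one (α β : Form 1) (x : V) (i j : Fin 7) :
    e.comp (wedge α β) x ![i, j] =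
      e.comp α x ![i] * e.comp β x ![j] - e.comp α x ![j] * e.comp β x ![i] := by
  obtain ⟨L, hL, hL'⟩ := e.exists_oneForm_eq_detForm α x
  obtain ⟨M, hM, hM'⟩ := e.exists_oneForm_eq_detForm β x
  rw [comp, wedge, hL, hM, wedgeAlt_detForm, ← hL', ← hL', ← hM', ← hM']
  have : Fin.append ![L] ![M] = ![L, M] := by funext s; fin_cases s <;> rfl
  rw [this]
  refine (detForm_apply _ _).trans ?_
  refine (Matrix.det_fin_two _).trans ?_
  simp
  ring

theorem oneForm_ext {α β : Form 1} (h : ∀ x k, e.comp α x ![k] = e.comp β x ![k]) : α = β := by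
  funext x
  rw [e.oneForm_eq_sum α, e.oneForm_eq_sum β]
  simp only [h]

theorem comp_sum_smul_form_one (f : Fin 7 → ℝ) (x : V) (k : Fin 7) :
    (∑ i, f i • e.form ![i] x) (fun a => e.frame (![k] a) x) = f k := by
  rw [ContinuousAlternatingMap.sum_apply]
  simp [form_one_apply, e.dual, Pi.single_apply]

/-- Exchanging two index pairs is even. With the next lemma, the three complementary products are
the same 7-form. -/
theorem wedge_form_0145_236 :
    wedge (e.form ![0, 1, 4, 5]) (e.form ![2, 3, 6]) =
      wedge (e.form ![0, 1, 2, 3]) (e.form ![4, 5, 6]) := by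
  have hp : Fin.append (![0, 1, 4, 5] : Fin 4 → Fin 7) ![2, 3, 6] =
      Fin.append ![0, 1, 2, 3] ![4, 5, 6] ∘
      ⇑(Equiv.swap 2 4 * Equiv.swap 3 5 : Equiv.Perm (Fin (4 + 3))) := by
    decide
  rw [e.wedge_form, e.wedge_form, hp, e.form_comp_perm,
    Equiv.Perm.sign_mul, Equiv.Perm.sign_swap (by decide), Equiv.Perm.sign_swap (by decide)]
  simp

theorem wedge_form_2345_016 :
    wedge (e.form ![2, 3, 4, 5]) (e.form ![0, 1, 6]) =
      wedge (e.form ![0, 1, 2, 3]) (e.form ![4, 5, 6]) := by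
  have hp : Fin.append (![2, 3, 4, 5] : Fin 4 → Fin 7) ![0, 1, 6] =
      Fin.append ![0, 1, 2, 3] ![4, 5, 6] ∘
      ⇑(Equiv.swap 0 4 * Equiv.swap 0 2 * (Equiv.swap 1 5 * Equiv.swap 1 3) :
        Equiv.Perm (Fin (4 + 3))) := by
    decide
  rw [e.wedge_form, e.wedge_form, hp, e.form_comp_perm,
    Equiv.Perm.sign_mul, Equiv.Perm.sign_mul, Equiv.Perm.sign_mul,
    Equiv.Perm.sign_swap (by decide), Equiv.Perm.sign_swap (by decide),
    Equiv.Perm.sign_swap (by decide), Equiv.Perm.sign_swap (by decide)]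
  simp

end Coframe

/-! ### The `G₂`-structure on `H(3,1)` and its torsion -/

section Heisenberg

variable (a b c : ℝ) (ha : a ≠ 0) (hb : b ≠ 0) (hc : c ≠ 0)

theorem heisCoframe_extDeriv_theta :
    extDeriv (heisCoframe a b c ha hb hc).theta =
      (a + b) • (heisCoframe a b c ha hb hc).form ![0, 1, 2, 3] +
      (a + c) • (heisCoframe a b c ha hb hc).form ![0, 1, 4, 5] +
      (b + c) • (heisCoframe a b c ha hb hc).form ![2, 3, 4, 5] := by
  set e := heisCoframe a b c ha hb hc with he
  have hd {k : ℕ} (I : Fin k → Fin 7) : Differentiable ℝ (e.form I) := e.differentiable_form I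
  have hz (I : Fin 3 → Fin 7) (hI : ∀ i, I i ≠ 6) : extDeriv (e.form I) = 0 :=
    heisCoframe_extDeriv_form_of_ne a b c ha hb hc I hI
  rw [Coframe.theta,
    extDeriv_add_form
      ((((((hd _).sub (hd _)).add (hd _)).add (hd _)).sub (hd _)).sub (hd _)) (hd _),
    extDeriv_sub_form (((((hd _).sub (hd _)).add (hd _)).add (hd _)).sub (hd _)) (hd _),
    extDeriv_sub_form ((((hd _).sub (hd _)).add (hd _)).add (hd _)) (hd _),
    extDeriv_add_form (((hd _).sub (hd _)).add (hd _)) (hd _),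
    extDeriv_add_form ((hd _).sub (hd _)) (hd _), extDeriv_sub_form (hd _) (hd _),
    hz ![1, 2, 5] (by decide), hz ![0, 3, 5] (by decide), hz ![1, 3, 4] (by decide),
    hz ![0, 2, 4] (by decide), he,
    heisCoframe_extDeriv_form_three a b c ha hb hc 0 1 (by decide) (by decide),
    heisCoframe_extDeriv_form_three a b c ha hb hc 2 3 (by decide) (by decide),
    heisCoframe_extDeriv_form_three a b c ha hb hc 4 5 (by decide) (by decide), ← he,
    e.form_eq_zero_of_eq ![0, 0, 1, 1] 0 1 rfl (by decide),
    e.form_eq_zero_of_eq ![2, 2, 3, 3] 0 1 rfl (by decide),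
    e.form_eq_zero_of_eq ![4, 4, 5, 5] 0 1 rfl (by decide),
    e.form_rotate_init 0 1 2 3, e.form_rotate_init 0 1 4 5, e.form_rotate_init 2 3 4 5,
    e.form_rotate_tail 0 1 2 3, e.form_rotate_tail 0 1 4 5, e.form_rotate_tail 2 3 4 5]
  module

/-- Each term of `*Θ` containing `e^7` has exactly one index from each of the pairs 12, 34, 56, so
every summand of `de^7` repeats an index. The other terms are constant. -/
theorem heisCoframe_extDeriv_starTheta :
    extDeriv (heisCoframe a b c ha hb hc).starTheta = 0 := by
  set e := heisCoframe a b c ha hb hc with he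
  have hd {k : ℕ} (I : Fin k → Fin 7) : Differentiable ℝ (e.form I) := e.differentiable_form I
  have hz (I : Fin 4 → Fin 7) (hI : ∀ i, I i ≠ 6) : extDeriv (e.form I) = 0 :=
    heisCoframe_extDeriv_form_of_ne a b c ha hb hc I hI
  have h5 (I : Fin 5 → Fin 7) (h : ∃ i j, I i = I j ∧ i ≠ j) : e.form I = 0 := by
    obtain ⟨i, j, hI, hij⟩ := h
    exact e.form_eq_zero_of_eq I i j hI hij
  rw [Coframe.starTheta_eq,
    extDeriv_sub_form
      ((((((hd _).add (hd _)).add (hd _)).add (hd _)).add (hd _)).add (hd _)) (hd _),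
    extDeriv_add_form (((((hd _).add (hd _)).add (hd _)).add (hd _)).add (hd _)) (hd _),
    extDeriv_add_form ((((hd _).add (hd _)).add (hd _)).add (hd _)) (hd _),
    extDeriv_add_form (((hd _).add (hd _)).add (hd _)) (hd _),
    extDeriv_add_form ((hd _).add (hd _)) (hd _), extDeriv_add_form (hd _) (hd _),
    hz ![2, 3, 4, 5] (by decide), hz ![0, 1, 4, 5] (by decide), hz ![0, 1, 2, 3] (by decide), he,
    heisCoframe_extDeriv_form_four a b c ha hb hc 0 3 4 (by decide) (by decide) (by decide),
    heisCoframe_extDeriv_form_four a b c ha hb hc 1 2 4 (by decide) (by decide) (by decide),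
    heisCoframe_extDeriv_form_four a b c ha hb hc 0 2 5 (by decide) (by decide) (by decide),
    heisCoframe_extDeriv_form_four a b c ha hb hc 1 3 5 (by decide) (by decide) (by decide), ← he,
    h5 ![0, 0, 3, 4, 1] (by decide), h5 ![2, 0, 3, 4, 3] (by decide),
    h5 ![4, 0, 3, 4, 5] (by decide), h5 ![0, 1, 2, 4, 1] (by decide),
    h5 ![2, 1, 2, 4, 3] (by decide), h5 ![4, 1, 2, 4, 5] (by decide),
    h5 ![0, 0, 2, 5, 1] (by decide), h5 ![2, 0, 2, 5, 3] (by decide),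
    h5 ![4, 0, 2, 5, 5] (by decide), h5 ![0, 1, 3, 5, 1] (by decide),
    h5 ![2, 1, 3, 5, 3] (by decide), h5 ![4, 1, 3, 5, 5] (by decide)]
  module

variable (habc : a + b + c = 0)
include habc

/-- The star sends `e^{1234}`, `e^{1256}`, `e^{3456}` to `e^{567}`, `e^{347}`, `e^{127}`, and the
coefficients `a + b`, `a + c`, `b + c` equal `-c`, `-b`, `-a`. -/
theorem heisCoframe_torsion :
    (heisCoframe a b c ha hb hc).torsion =
      a • (heisCoframe a b c ha hb hc).form ![0, 1, 6] +
      b • (heisCoframe a b c ha hb hc).form ![2, 3, 6] +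
      c • (heisCoframe a b c ha hb hc).form ![4, 5, 6] := by
  have h1 : a + b = -c := by linarith
  have h2 : a + c = -b := by linarith
  have h3 : b + c = -a := by linarith
  rw [Coframe.torsion, heisCoframe_extDeriv_theta, h1, h2, h3, Coframe.hodge_add,
    Coframe.hodge_add, Coframe.hodge_smul, Coframe.hodge_smul, Coframe.hodge_smul,
    Coframe.hodge_form _ rfl (I := ![0, 1, 2, 3]) (J := ![4, 5, 6]) (by decide) (by decide) 1
      (by decide) (by decide),
    Coframe.hodge_form _ rfl (I := ![0, 1, 4, 5]) (J := ![2, 3, 6]) (by decide) (by decide) 1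
      (by decide) (by decide),
    Coframe.hodge_form _ rfl (I := ![2, 3, 4, 5]) (J := ![0, 1, 6]) (by decide) (by decide) 1
      (by decide) (by decide)]
  simp only [Int.cast_one, one_smul]
  module

theorem heisCoframe_extDeriv_torsion :
    extDeriv (heisCoframe a b c ha hb hc).torsion =
      wedge ((heisCoframe a b c ha hb hc).blockForm a b c)
        ((heisCoframe a b c ha hb hc).blockForm a b c) := by
  rw [heisCoframe_torsion a b c ha hb hc habc, Coframe.wedge_blockForm]
  set e := heisCoframe a b c ha hb hc with he
  have hd {k : ℕ} (r : ℝ) (I : Fin k → Fin 7) : Differentiable ℝ (r • e.form I) :=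
    (e.differentiable_form I).const_smul r
  rw [extDeriv_add_form ((hd _ _).add (hd _ _)) (hd _ _), extDeriv_add_form (hd _ _) (hd _ _),
    extDeriv_smul_form, extDeriv_smul_form, extDeriv_smul_form, he,
    heisCoframe_extDeriv_form_three a b c ha hb hc 0 1 (by decide) (by decide),
    heisCoframe_extDeriv_form_three a b c ha hb hc 2 3 (by decide) (by decide),
    heisCoframe_extDeriv_form_three a b c ha hb hc 4 5 (by decide) (by decide), ← he,
    e.form_eq_zero_of_eq ![0, 0, 1, 1] 0 1 rfl (by decide),
    e.form_eq_zero_of_eq ![2, 2, 3, 3] 0 1 rfl (by decide),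
    e.form_eq_zero_of_eq ![4, 4, 5, 5] 0 1 rfl (by decide),
    e.form_rotate_init 0 1 2 3, e.form_rotate_init 0 1 4 5, e.form_rotate_init 2 3 4 5,
    e.form_rotate_tail 0 1 2 3, e.form_rotate_tail 0 1 4 5, e.form_rotate_tail 2 3 4 5]
  module

/-- Only the three products of complementary indices survive, all equal to one 7-form; their
coefficients sum to `2 (a + b + c) = 0`. -/
theorem heisCoframe_wedge_extDeriv_theta_theta :
    wedge (extDeriv (heisCoframe a b c ha hb hc).theta) (heisCoframe a b c ha hb hc).theta = 0 := by
  rw [heisCoframe_extDeriv_theta]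
  set e := heisCoframe a b c ha hb hc with he
  have h2 := e.wedge_form_0145_236
  have h3 := e.wedge_form_2345_016
  have hz := fun (I : Fin 4 → Fin 7) (J : Fin 3 → Fin 7) => e.wedge_form_eq_zero I J
  have hs : b + c = -(a + b) - (a + c) := by linarith
  rw [hs, ← wedgeₗ_apply, Coframe.theta]
  simp only [map_add, map_sub, map_smul, LinearMap.add_apply, LinearMap.smul_apply, wedgeₗ_apply,
    h2, h3, hz ![0, 1, 2, 3] ![0, 1, 6] (by decide), hz ![0, 1, 2, 3] ![1, 2, 5] (by decide),
    hz ![0, 1, 2, 3] ![2, 3, 6] (by decide), hz ![0, 1, 2, 3] ![0, 3, 5] (by decide),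
    hz ![0, 1, 2, 3] ![1, 3, 4] (by decide), hz ![0, 1, 2, 3] ![0, 2, 4] (by decide),
    hz ![0, 1, 4, 5] ![0, 1, 6] (by decide), hz ![0, 1, 4, 5] ![1, 2, 5] (by decide),
    hz ![0, 1, 4, 5] ![4, 5, 6] (by decide), hz ![0, 1, 4, 5] ![0, 3, 5] (by decide),
    hz ![0, 1, 4, 5] ![1, 3, 4] (by decide), hz ![0, 1, 4, 5] ![0, 2, 4] (by decide),
    hz ![2, 3, 4, 5] ![2, 3, 6] (by decide), hz ![2, 3, 4, 5] ![1, 2, 5] (by decide),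
    hz ![2, 3, 4, 5] ![4, 5, 6] (by decide), hz ![2, 3, 4, 5] ![0, 3, 5] (by decide),
    hz ![2, 3, 4, 5] ![1, 3, 4] (by decide), hz ![2, 3, 4, 5] ![0, 2, 4] (by decide)]
  generalize wedge (e.form ![0, 1, 2, 3]) (e.form ![4, 5, 6]) = η
  module

end Heisenberg

/-- The components of the Levi-Civita connection of `H(3,1)`. -/
def heisChristoffel (a b c : ℝ) (i j k : Fin 7) : ℝ :=
  1 / 2 * ((if i = 6 then 1 else 0) * blockSkew a b c j k -
    (if k = 6 then 1 else 0) * blockSkew a b c i j + (if j = 6 then 1 else 0) * blockSkew a b c k i)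

/-- The components of the torsion `3`-form of `H(3,1)`. -/
def heisFlux (a b c : ℝ) (i j k : Fin 7) : ℝ :=
  blockSkew a b c i j * (if k = 6 then 1 else 0) + blockSkew a b c j k * (if i = 6 then 1 else 0) +
    blockSkew a b c k i * (if j = 6 then 1 else 0)

/-! ### Levi-Civita connection and curvature -/

section Heisenberg

variable (a b c : ℝ) (ha : a ≠ 0) (hb : b ≠ 0) (hc : c ≠ 0)

theorem heisCoframe_structureFn (k i j : Fin 7) (x : V) :
    (heisCoframe a b c ha hb hc).structureFn k i j x =
      (if k = 6 then 1 else 0) * blockSkew a b c i j := by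
  rw [Coframe.structureFn, heisCoframe_extDeriv_form_one, Coframe.comp_smul,
    Coframe.comp_blockForm]

theorem heisCoframe_leviCivita (i j : Fin 7) :
    (heisCoframe a b c ha hb hc).leviCivita i j =
      ∑ k, heisChristoffel a b c i j k • (heisCoframe a b c ha hb hc).form ![k] := by
  funext x
  simp only [Coframe.leviCivita, heisCoframe_structureFn, heisChristoffel, Finset.sum_apply,
    Pi.smul_apply]

theorem heisCoframe_comp_leviCivita (i j k : Fin 7) (x : V) :
    (heisCoframe a b c ha hb hc).comp ((heisCoframe a b c ha hb hc).leviCivita i j) x ![k] =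
      heisChristoffel a b c i j k := by
  rw [heisCoframe_leviCivita, Coframe.comp, Finset.sum_apply]
  exact Coframe.comp_sum_smul_form_one _ _ x k

/-- The coefficients in the invariant coframe are constant, so only the `e^7` term contributes. -/
theorem heisCoframe_extDeriv_leviCivita (i j : Fin 7) :
    extDeriv ((heisCoframe a b c ha hb hc).leviCivita i j) =
      heisChristoffel a b c i j 6 • (heisCoframe a b c ha hb hc).blockForm a b c := by
  rw [heisCoframe_leviCivita]
  simp only [Fin.sum_univ_seven]
  have hd (r : ℝ) (k : Fin 7) : Differentiable ℝ (r • (heisCoframe a b c ha hb hc).form ![k]) :=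
    (Coframe.differentiable_form _ _).const_smul r
  rw [extDeriv_add_form ((((((hd _ _).add (hd _ _)).add (hd _ _)).add (hd _ _)).add
      (hd _ _)).add (hd _ _)) (hd _ _),
    extDeriv_add_form (((((hd _ _).add (hd _ _)).add (hd _ _)).add (hd _ _)).add (hd _ _))
      (hd _ _),
    extDeriv_add_form ((((hd _ _).add (hd _ _)).add (hd _ _)).add (hd _ _)) (hd _ _),
    extDeriv_add_form (((hd _ _).add (hd _ _)).add (hd _ _)) (hd _ _),
    extDeriv_add_form ((hd _ _).add (hd _ _)) (hd _ _), extDeriv_add_form (hd _ _) (hd _ _)]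
  simp only [extDeriv_smul_form, heisCoframe_extDeriv_form_one]
  simp

theorem Coframe.comp_sum (e : Coframe) {k : ℕ} {ι : Type*} (s : Finset ι) (α : ι → Form k) (x : V)
    (I : Fin k → Fin 7) : e.comp (∑ i ∈ s, α i) x I = ∑ i ∈ s, e.comp (α i) x I := by
  rw [Coframe.comp, Finset.sum_apply, ContinuousAlternatingMap.sum_apply]
  rfl

theorem heisCoframe_comp_leviCivita_curvature (i j p q : Fin 7) (x : V) :
    (heisCoframe a b c ha hb hc).comp
        ((heisCoframe a b c ha hb hc).leviCivita.curvature i j) x ![p, q] =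
      heisChristoffel a b c i j 6 * blockSkew a b c p q +
        ∑ k, (heisChristoffel a b c i k p * heisChristoffel a b c k j q -
          heisChristoffel a b c i k q * heisChristoffel a b c k j p) := by
  rw [Conn.curvature, Coframe.comp_add, heisCoframe_extDeriv_leviCivita, Coframe.comp_smul,
    Coframe.comp_blockForm, Coframe.comp_sum]
  simp only [Coframe.comp_wedge_one_one, heisCoframe_comp_leviCivita]

/-! ### The connections `A_{λ,μ,τ}` -/

/-- Every connection form is a multiple of `e^7` and `e^7 ∧ e^7 = 0`, so only `d` of the connection
forms remains. -/
theorem heisCoframe_curvature_instantonConn (l m t : ℝ) (i j : Fin 7) :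
    (instantonConn (heisCoframe a b c ha hb hc) l m t).curvature i j =
      blockSkew l m t i j • (heisCoframe a b c ha hb hc).blockForm a b c := by
  have hw (r s : ℝ) : wedge (r • (heisCoframe a b c ha hb hc).form ![6])
      (s • (heisCoframe a b c ha hb hc).form ![6]) = 0 := by
    rw [← wedgeₗ_apply, map_smul, map_smul, LinearMap.smul_apply, wedgeₗ_apply,
      Coframe.wedge_form_eq_zero _ _ _ ⟨0, 0, rfl⟩, smul_zero, smul_zero]
  simp only [Conn.curvature, instantonConn_apply, hw, Finset.sum_const_zero, add_zero]
  rw [extDeriv_smul_form, heisCoframe_extDeriv_form_six]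

theorem heisCoframe_pontrjagin_instantonConn (l m t : ℝ) :
    (instantonConn (heisCoframe a b c ha hb hc) l m t).pontrjagin =
      ((l ^ 2 + m ^ 2 + t ^ 2) / (8 * Real.pi ^ 2)) •
        wedge ((heisCoframe a b c ha hb hc).blockForm a b c)
          ((heisCoframe a b c ha hb hc).blockForm a b c) := by
  have hw (r : ℝ) : wedge (r • (heisCoframe a b c ha hb hc).blockForm a b c)
      (r • (heisCoframe a b c ha hb hc).blockForm a b c) =
      (r * r) • wedge ((heisCoframe a b c ha hb hc).blockForm a b c)
          ((heisCoframe a b c ha hb hc).blockForm a b c) := by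
    rw [← wedgeₗ_apply, map_smul, map_smul, LinearMap.smul_apply, wedgeₗ_apply, smul_smul]
  simp only [Conn.pontrjagin, heisCoframe_curvature_instantonConn, hw, ← Finset.sum_smul]
  rw [sum_blockSkew_sq, smul_smul]
  congr 1
  ring

theorem heisCoframe_comp_curvature_instantonConn (l m t : ℝ) (i j p q : Fin 7) (x : V) :
    (heisCoframe a b c ha hb hc).comp
        ((instantonConn (heisCoframe a b c ha hb hc) l m t).curvature i j) x ![p, q] =
      blockSkew l m t i j * blockSkew a b c p q := by
  rw [heisCoframe_curvature_instantonConn, Coframe.comp_smul, Coframe.comp_blockForm]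

theorem Coframe.comp_instantonConn (e : Coframe) (l m t : ℝ) (i j k : Fin 7) (x : V) :
    e.comp (instantonConn e l m t i j) x ![k] =
      blockSkew l m t i j * (if k = 6 then 1 else 0) := by
  rw [instantonConn_apply, Coframe.comp_smul, Coframe.comp_form_one]
  simp only [eq_comm]

theorem heisCoframe_curvatureSquare_instantonConn (l m t : ℝ) (i j : Fin 7) (x : V) :
    (heisCoframe a b c ha hb hc).curvatureSquare
        (instantonConn (heisCoframe a b c ha hb hc) l m t) i j x =
      (l ^ 2 + m ^ 2 + t ^ 2) * ∑ k, blockSkew a b c i k * blockSkew a b c j k := by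
  simp only [Coframe.curvatureSquare, heisCoframe_comp_curvature_instantonConn]
  rw [← sum_blockSkew_sq, Finset.mul_sum]
  refine Finset.sum_congr rfl fun k _ => ?_
  rw [Finset.sum_mul]
  refine Finset.sum_congr rfl fun p _ => ?_
  rw [Finset.sum_mul]
  refine Finset.sum_congr rfl fun q _ => ?_
  ring

theorem Coframe.instantonConn_isMetric (e : Coframe) (l m t : ℝ) :
    (instantonConn e l m t).IsMetric := by
  intro i j
  rw [instantonConn_apply, instantonConn_apply, blockSkew_swap l m t j i]
  module

/-! ### The Bismut connection -/

variable (habc : a + b + c = 0)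
include habc

theorem heisCoframe_comp_torsion (i j k : Fin 7) (x : V) :
    (heisCoframe a b c ha hb hc).comp (heisCoframe a b c ha hb hc).torsion x ![i, j, k] =
      heisFlux a b c i j k := by
  rw [heisCoframe_torsion a b c ha hb hc habc, Coframe.comp_add, Coframe.comp_add,
    Coframe.comp_smul, Coframe.comp_smul, Coframe.comp_smul, Coframe.comp_form_three,
    Coframe.comp_form_three, Coframe.comp_form_three, heisFlux]
  have h := fun p q => (heisCoframe a b c ha hb hc).comp_blockForm a b c p q x
  simp only [Coframe.blockForm, Coframe.comp_add, Coframe.comp_smul] at h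
  rw [← h, ← h, ← h]
  simp only [eq_comm (a := (6 : Fin 7))]
  ring

/-- By skew-symmetry of `ω`, half the torsion cancels the Christoffel terms with `i = 6` or `j = 6`
and doubles the term with `k = 6`, leaving `-ω_ij e^7`. -/
theorem heisCoframe_plusConn :
    (heisCoframe a b c ha hb hc).plusConn (heisCoframe a b c ha hb hc).torsion =
      instantonConn (heisCoframe a b c ha hb hc) (-a) (-b) (-c) := by
  funext i j
  refine (heisCoframe a b c ha hb hc).oneForm_ext fun x k => ?_
  have hp : (heisCoframe a b c ha hb hc).plusConn (heisCoframe a b c ha hb hc).torsion i j =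
      (heisCoframe a b c ha hb hc).leviCivita i j +
        ∑ k, (1 / 2 * heisFlux a b c k j i) • (heisCoframe a b c ha hb hc).form ![k] := by
    funext y
    simp only [Coframe.plusConn, heisCoframe_comp_torsion a b c ha hb hc habc, Pi.add_apply,
      Finset.sum_apply, Pi.smul_apply]
  rw [hp, Coframe.comp_add, heisCoframe_comp_leviCivita, Coframe.comp_instantonConn, Coframe.comp,
    Finset.sum_apply]
  refine (congrArg _ (Coframe.comp_sum_smul_form_one _ _ x k)).trans ?_
  rw [blockSkew_neg, heisChristoffel, heisFlux, blockSkew_swap a b c k j, blockSkew_swap a b c i j,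
    blockSkew_swap a b c k i]
  ring

end Heisenberg

set_option maxHeartbeats 4000000 in
/-- In components, `Ric_{ij} - (1/4) H_{imn} H_{jmn} + ∑ k, (de⁷)_{ik} (de⁷)_{jk} = 0`. -/
theorem heisFlux_einstein (a b c : ℝ) (i j : Fin 7) :
    (∑ k, (heisChristoffel a b c k j 6 * blockSkew a b c k i +
        ∑ s, (heisChristoffel a b c k s k * heisChristoffel a b c s j i -
          heisChristoffel a b c k s i * heisChristoffel a b c s j k))) -
      1 / 4 * ∑ m, ∑ n, heisFlux a b c i m n * heisFlux a b c j m n +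
      ∑ k, blockSkew a b c i k * blockSkew a b c j k = 0 := by
  fin_cases i <;> fin_cases j <;>
    simp [heisChristoffel, heisFlux, Fin.sum_univ_seven, blockSkew] <;> ring

set_option maxHeartbeats 4000000 in
/-- The flux is divergence free for the Levi-Civita connection. -/
theorem heisFlux_divergence (a b c : ℝ) (j k : Fin 7) :
    ∑ i, ∑ s, (heisChristoffel a b c s i i * heisFlux a b c s j k +
      heisChristoffel a b c s j i * heisFlux a b c i s k +
      heisChristoffel a b c s k i * heisFlux a b c i j s) = 0 := by
  fin_cases j <;> fin_cases k <;>
    simp [heisChristoffel, heisFlux, Fin.sum_univ_seven, blockSkew]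

/-! ## The parallel spinor -/

/-- The real part of `(1, i) ⊗ (1, i) ⊗ (1, i)`. -/
def spinorRe : Spinor := fun s => (![1, 0, -1, 0] : Fin 4 → ℝ) ⟨s.1 + s.2.1 + s.2.2, by omega⟩

/-- The imaginary part of `(1, i) ⊗ (1, i) ⊗ (1, i)`. -/
def spinorIm : Spinor := fun s => (![0, 1, 0, -1] : Fin 4 → ℝ) ⟨s.1 + s.2.1 + s.2.2, by omega⟩

theorem gamma_mul_swap {i j : Fin 7} (h : i ≠ j) : gamma i * gamma j = -(gamma j * gamma i) := by
  have := gamma_clifford i j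
  rw [if_neg h] at this
  exact eq_neg_of_add_eq_zero_left this

open scoped Kronecker in
-- The representation is arranged so that each of the three pair products acts as `pauliE` on a
-- single tensor factor, a different one for each pair.
theorem gamma_zero_mul_one : gamma 0 * gamma 1 = 1 ⊗ₖ (pauliE ⊗ₖ 1) := by
  have h : (pauliE * pauliE) = -1 := by
    ext i j; fin_cases i <;> fin_cases j <;> simp [pauliE]
  have h' : (pauli1 * pauli3) = -pauliE := by
    ext i j; fin_cases i <;> fin_cases j <;> simp [pauliE, pauli1, pauli3]
  simp only [gamma, Matrix.cons_val_zero, Matrix.cons_val_one, ← Matrix.mul_kronecker_mul, h, h']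
  ext ⟨i, j, k⟩ ⟨i', j', k'⟩
  simp

open scoped Kronecker in
theorem gamma_two_mul_three : gamma 2 * gamma 3 = 1 ⊗ₖ (1 ⊗ₖ pauliE) := by
  have h : (pauliE * pauliE) = -1 := by
    ext i j; fin_cases i <;> fin_cases j <;> simp [pauliE]
  have h' : (pauli1 * pauli3) = -pauliE := by
    ext i j; fin_cases i <;> fin_cases j <;> simp [pauliE, pauli1, pauli3]
  simp only [gamma, Matrix.cons_val, ← Matrix.mul_kronecker_mul, h, h']
  ext ⟨i, j, k⟩ ⟨i', j', k'⟩
  simp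

open scoped Kronecker in
theorem gamma_four_mul_five : gamma 4 * gamma 5 = pauliE ⊗ₖ (1 ⊗ₖ 1) := by
  have h : (pauliE * pauliE) = -1 := by
    ext i j; fin_cases i <;> fin_cases j <;> simp [pauliE]
  have h' : (pauli1 * pauli3) = -pauliE := by
    ext i j; fin_cases i <;> fin_cases j <;> simp [pauliE, pauli1, pauli3]
  simp only [gamma, Matrix.cons_val, ← Matrix.mul_kronecker_mul, h, h']
  ext ⟨i, j, k⟩ ⟨i', j', k'⟩
  simp [-Matrix.kroneckerMap_one_one]

/-- Since `pauliE (1, i) = i (1, i)`, each pair product multiplies `(1, i) ⊗ (1, i) ⊗ (1, i)` by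
`i`; the real part therefore goes to minus the imaginary part. -/
theorem gamma_pairs_mulVec_spinorRe :
    (gamma 0 * gamma 1).mulVec spinorRe = -spinorIm ∧
    (gamma 2 * gamma 3).mulVec spinorRe = -spinorIm ∧
    (gamma 4 * gamma 5).mulVec spinorRe = -spinorIm := by
  rw [gamma_zero_mul_one, gamma_two_mul_three, gamma_four_mul_five]
  refine ⟨?_, ?_, ?_⟩ <;>
  · funext ⟨i, j, k⟩
    fin_cases i <;> fin_cases j <;> fin_cases k <;>
      simp [Matrix.mulVec, dotProduct, Fintype.sum_prod_type, pauliE, spinorRe, spinorIm,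
        Matrix.one_apply]

theorem gamma_pairs_mulVec_spinorIm :
    (gamma 0 * gamma 1).mulVec spinorIm = spinorRe ∧
    (gamma 2 * gamma 3).mulVec spinorIm = spinorRe ∧
    (gamma 4 * gamma 5).mulVec spinorIm = spinorRe := by
  rw [gamma_zero_mul_one, gamma_two_mul_three, gamma_four_mul_five]
  refine ⟨?_, ?_, ?_⟩ <;>
  · funext ⟨i, j, k⟩
    fin_cases i <;> fin_cases j <;> fin_cases k <;>
      simp [Matrix.mulVec, dotProduct, Fintype.sum_prod_type, pauliE, spinorRe, spinorIm,
        Matrix.one_apply]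

/-- Here all three factors contribute, giving the eigenvalue `i³ = -i`. -/
theorem gamma_six_mulVec_spinorRe : (gamma 6).mulVec spinorRe = spinorIm := by
  funext ⟨i, j, k⟩
  fin_cases i <;> fin_cases j <;> fin_cases k <;>
    simp [gamma, Matrix.mulVec, dotProduct, Fintype.sum_prod_type, pauliE, spinorRe, spinorIm]

section BlockSums

variable (a b c : ℝ)

theorem sum_blockSkew_smul_gamma_mulVec (ε : Spinor) :
    ∑ m, ∑ n, blockSkew a b c m n • (gamma m * gamma n).mulVec ε =
      (2 : ℝ) • (a • (gamma 0 * gamma 1).mulVec ε + b • (gamma 2 * gamma 3).mulVec ε +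
        c • (gamma 4 * gamma 5).mulVec ε) := by
  simp only [Fin.sum_univ_seven]
  simp only [blockSkew, Matrix.of_apply, Matrix.cons_val]
  rw [gamma_mul_swap (i := 1) (j := 0) (by decide), gamma_mul_swap (i := 3) (j := 2) (by decide),
    gamma_mul_swap (i := 5) (j := 4) (by decide), Matrix.neg_mulVec, Matrix.neg_mulVec,
    Matrix.neg_mulVec]
  module

variable (habc : a + b + c = 0)
include habc

theorem sum_blockSkew_gamma_spinorRe :
    ∑ m, ∑ n, blockSkew a b c m n • (gamma m * gamma n).mulVec spinorRe = 0 := by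
  obtain ⟨h1, h2, h3⟩ := gamma_pairs_mulVec_spinorRe
  rw [sum_blockSkew_smul_gamma_mulVec, h1, h2, h3, ← add_smul, ← add_smul, habc, zero_smul,
    smul_zero]

theorem sum_blockSkew_gamma_spinorIm :
    ∑ m, ∑ n, blockSkew a b c m n • (gamma m * gamma n).mulVec spinorIm = 0 := by
  obtain ⟨h1, h2, h3⟩ := gamma_pairs_mulVec_spinorIm
  rw [sum_blockSkew_smul_gamma_mulVec, h1, h2, h3, ← add_smul, ← add_smul, habc, zero_smul,
    smul_zero]

/-- The spinorial derivative pairs `σ^i_j` with `γ_j γ_i`; this version of the sum has that index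
order. -/
theorem sum_blockSkew_gamma_swap_spinorRe :
    ∑ m, ∑ n, blockSkew a b c m n • (gamma n * gamma m).mulVec spinorRe = 0 := by
  have h := sum_blockSkew_gamma_spinorRe a b c habc
  rw [Finset.sum_comm] at h
  have h' : ∑ m, ∑ n, -(blockSkew a b c m n • (gamma n * gamma m).mulVec spinorRe) = 0 := by
    rw [← h]
    refine Finset.sum_congr rfl fun m _ => Finset.sum_congr rfl fun n _ => ?_
    rw [blockSkew_swap a b c m n, neg_smul]
  simpa only [Finset.sum_neg_distrib, neg_eq_zero] using h'

/-- The three cyclic terms of the flux differ in the place of `γ₇`. On the right it moves the spinor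
to `spinorIm`, which `ω` also kills; on the left it acts after `ω`; in the middle it is moved left
by anticommutation. -/
theorem sum_heisFlux_gamma_spinorRe :
    ∑ m, ∑ n, ∑ p, heisFlux a b c m n p • (gamma m * gamma n * gamma p).mulVec spinorRe = 0 := by
  have h1 : ∑ m, ∑ n, ∑ p, (blockSkew a b c m n * (if p = 6 then 1 else 0)) •
      (gamma m * gamma n * gamma p).mulVec spinorRe = 0 := by
    rw [← sum_blockSkew_gamma_spinorIm a b c habc]
    refine Finset.sum_congr rfl fun m _ => Finset.sum_congr rfl fun n _ => ?_
    simp [← Matrix.mulVec_mulVec, gamma_six_mulVec_spinorRe]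
  have h2 : ∑ m, ∑ n, ∑ p, (blockSkew a b c n p * (if m = 6 then 1 else 0)) •
      (gamma m * gamma n * gamma p).mulVec spinorRe = 0 := by
    rw [Finset.sum_eq_single 6]
    · have h := congrArg (gamma 6).mulVec (sum_blockSkew_gamma_spinorRe a b c habc)
      rw [Matrix.mulVec_zero] at h
      rw [← h]
      simp only [Matrix.mulVec_sum, Matrix.mulVec_smul, Matrix.mulVec_mulVec, mul_assoc, if_true,
        mul_one]
    · intro m _ hm
      simp [hm]
    · simp
  have h3 : ∑ m, ∑ n, ∑ p, (blockSkew a b c p m * (if n = 6 then 1 else 0)) •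
      (gamma m * gamma n * gamma p).mulVec spinorRe = 0 := by
    have h := congrArg (gamma 6).mulVec (sum_blockSkew_gamma_swap_spinorRe a b c habc)
    rw [Matrix.mulVec_zero] at h
    rw [← neg_eq_zero, ← h, Finset.sum_comm, Finset.sum_eq_single 6]
    · rw [Finset.sum_comm (f := fun m n => blockSkew a b c m n • (gamma n * gamma m).mulVec _)]
      simp only [Matrix.mulVec_sum, Matrix.mulVec_smul, Matrix.mulVec_mulVec, ← mul_assoc, if_true,
        mul_one, ← Finset.sum_neg_distrib]
      refine Finset.sum_congr rfl fun m _ => Finset.sum_congr rfl fun p _ => ?_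
      -- Anticommutation fails only for equal indices, where the coefficient vanishes.
      by_cases hm : m = 6
      · have : blockSkew a b c p m = 0 := by
          subst hm; fin_cases p <;> simp [blockSkew]
        rw [this, zero_smul, zero_smul, neg_zero]
      · rw [gamma_mul_swap hm, Matrix.neg_mul, Matrix.neg_mulVec, smul_neg, neg_neg]
    · intro n _ hn
      simp [hn]
    · simp
  simp only [heisFlux, add_smul, Finset.sum_add_distrib]
  rw [h1, h2, h3, add_zero, add_zero]

end BlockSums

/-! ## The nilmanifold -/

instance : T2Space Heis := inferInstanceAs (T2Space V)

instance : LocallyCompactSpace Heis := inferInstanceAs (LocallyCompactSpace V)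

instance : IsTopologicalGroup Heis where
  continuous_mul := by
    change Continuous fun p : V × V => heisMul p.1 p.2
    refine continuous_pi fun i => ?_
    fin_cases i <;> simp [heisMul] <;> fun_prop
  continuous_inv := by
    change Continuous heisInv
    refine continuous_pi fun i => ?_
    fin_cases i <;> simp [heisInv] <;> fun_prop

theorem mem_Gamma31_iff (p : V) : (p : Heis) ∈ Gamma31 ↔ ∃ n : Fin 7 → ℤ, ∀ i, p i = n i := by
  constructor
  · intro h
    choose m hm using h
    refine ⟨![m 0 1, m 1 4, m 0 2, m 2 4, m 0 3, m 3 4, m 0 4], fun i => ?_⟩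
    fin_cases i
    · exact hm 0 1
    · exact hm 1 4
    · exact hm 0 2
    · exact hm 2 4
    · exact hm 0 3
    · exact hm 3 4
    · exact hm 0 4
  · rintro ⟨n, hn⟩ i j
    refine ⟨!![1, n 0, n 2, n 4, n 6; 0, 1, 0, 0, n 1; 0, 0, 1, 0, n 3; 0, 0, 0, 1, n 5;
      0, 0, 0, 0, 1] i j, ?_⟩
    fin_cases i <;> fin_cases j <;> simp [heisMatrix, hn]

/-- A compact set is bounded in coordinates, and lattice elements have integer coordinates, so only
finitely many lie in it. This gives proper discontinuity of the action. -/
theorem tendsto_Gamma31_subtype :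
    Filter.Tendsto Gamma31.subtype Filter.cofinite (Filter.cocompact Heis) := by
  rw [Filter.tendsto_def]
  intro s hs
  obtain ⟨K, hK, hKs⟩ := Filter.mem_cocompact.1 hs
  rw [Filter.mem_cofinite]
  choose f hf using fun g : Gamma31 => (mem_Gamma31_iff g.1).1 g.2
  have hK' : @IsCompact V _ K := hK
  obtain ⟨R, hR⟩ := hK'.isBounded.exists_norm_le
  have hfin : (f ⁻¹' Set.Icc (fun _ => -⌈R⌉) fun _ => ⌈R⌉).Finite := by
    refine (Set.finite_Icc _ _).preimage (Function.Injective.injOn fun g h hgh => ?_)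
    refine Subtype.ext (funext fun i => ?_)
    exact (hf g i).trans ((congrArg (fun n : ℤ => (n : ℝ)) (congrFun hgh i)).trans (hf h i).symm)
  refine hfin.subset fun g hg => ?_
  have hgK : g.1 ∈ K := by
    by_contra hn
    exact hg (hKs hn)
  have hb (i : Fin 7) : |(f g i : ℝ)| ≤ ⌈R⌉ := by
    rw [← hf g i, ← Real.norm_eq_abs]
    exact ((norm_le_pi_norm (g.1 : V) i).trans (hR _ hgK)).trans (Int.le_ceil R)
  refine Set.mem_Icc.2 ⟨fun i => ?_, fun i => ?_⟩
  · exact_mod_cast (abs_le.1 (hb i)).1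
  · exact_mod_cast (abs_le.1 (hb i)).2

instance : ProperlyDiscontinuousSMul Gamma31 Heis :=
  Gamma31.properlyDiscontinuousSMul_of_tendsto_cofinite tendsto_Gamma31_subtype

theorem isQuotientCoveringMap_toN31 : IsQuotientCoveringMap toN31 Gamma31 :=
  isQuotientCoveringMap_quotientMk_of_properlyDiscontinuousSMul (G := Gamma31) (E := Heis)

theorem t2Space_N31 : T2Space N31 :=
  t2Space_of_properlyDiscontinuousSMul_of_t2Space (Γ := Gamma31) (T := Heis)

/-- The unit cube is a fundamental domain. -/
theorem exists_Gamma31_mul_mem_Icc (p : V) :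
    ∃ g ∈ Gamma31, heisMul g p ∈ Set.Icc (0 : V) 1 := by
  set n : Fin 7 → ℤ := fun i => -⌊p i⌋ with hn
  -- Translating the first six coordinates into the cube shifts the last one by `n 0 * p 1 + n 2 * p
  -- 3 + n 4 * p 5`; its integer correction must be the floor of the shifted value `z`.
  set z : ℝ := p 6 + (n 0 * p 1 + n 2 * p 3 + n 4 * p 5) with hz
  refine ⟨fun i => (Function.update n 6 (-⌊z⌋) i : ℤ), (mem_Gamma31_iff _).2 ⟨_, fun i => rfl⟩,
    fun i => ?_, fun i => ?_⟩
  · have h0 := Int.floor_le (p i)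
    have h1 := Int.floor_le z
    fin_cases i <;> simp [heisMul, Function.update, hn] at h0 ⊢ <;> simp [hz, hn] at h1 ⊢ <;>
      linarith
  · have h0 := (Int.lt_floor_add_one (p i)).le
    have h1 := (Int.lt_floor_add_one z).le
    fin_cases i <;> simp [heisMul, Function.update, hn] at h0 ⊢ <;> simp [hz, hn] at h1 ⊢ <;>
      linarith

theorem compactSpace_N31 : CompactSpace N31 := by
  refine ⟨?_⟩
  have hK (K : Set V) (h : @IsCompact V _ K) : @IsCompact Heis _ K := h
  have himg : toN31 '' (Set.Icc (0 : V) 1 : Set V) = Set.univ := by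
    refine Set.eq_univ_of_forall fun q => ?_
    obtain ⟨p, rfl⟩ := isQuotientCoveringMap_toN31.surjective q
    obtain ⟨g, hg, hp⟩ := exists_Gamma31_mul_mem_Icc p
    exact ⟨heisMul g p, hp, isQuotientCoveringMap_toN31.map_smul (⟨g, hg⟩ : Gamma31)⟩
  rw [← himg]
  exact (hK _ isCompact_Icc).image isQuotientCoveringMap_toN31.continuous

/-! ## Invariant forms -/

theorem descendsForm_add {k : ℕ} {α β : Form k} (hα : DescendsForm α) (hβ : DescendsForm β) :
    DescendsForm (α + β) := by
  intro g hg x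
  have h := congrArg₂ (· + ·) (hα g hg x) (hβ g hg x)
  exact h

theorem descendsForm_smul {k : ℕ} (r : ℝ) {α : Form k} (hα : DescendsForm α) :
    DescendsForm (r • α) := by
  intro g hg x
  have h := congrArg (r • ·) (hα g hg x)
  exact h

theorem descendsForm_sub {k : ℕ} {α β : Form k} (hα : DescendsForm α) (hβ : DescendsForm β) :
    DescendsForm (α - β) := by
  intro g hg x
  have h := congrArg₂ (· - ·) (hα g hg x) (hβ g hg x)
  exact h

/-- The linear part of the left translation by `g`. -/
def heisLeft (g : V) : V →L[ℝ] V := LinearMap.toContinuousLinearMap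
  { toFun := fun v => ![v 0, v 1, v 2, v 3, v 4, v 5, v 6 + (g 0 * v 1 + g 2 * v 3 + g 4 * v 5)]
    map_add' := by
      intro v w
      funext i
      fin_cases i <;> simp
      ring
    map_smul' := by
      intro r v
      funext i
      fin_cases i <;> simp
      ring }

theorem heisLeft_apply (g v : V) : heisLeft g v =
    ![v 0, v 1, v 2, v 3, v 4, v 5, v 6 + (g 0 * v 1 + g 2 * v 3 + g 4 * v 5)] := rfl

theorem fderiv_heisMul (g x : V) : fderiv ℝ (heisMul g) x = heisLeft g := by
  have h : heisMul g = fun y => g + heisLeft g y := by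
    funext y i
    rw [heisLeft_apply]
    fin_cases i <;> simp [heisMul]
    ring
  rw [h, fderiv_const_add]
  exact (heisLeft g).fderiv

theorem heisCoframe_descendsForm_form (a b c : ℝ) (ha : a ≠ 0) (hb : b ≠ 0) (hc : c ≠ 0) {k : ℕ}
    (I : Fin k → Fin 7) : DescendsForm ((heisCoframe a b c ha hb hc).form I) := by
  -- The forms are invariant under all left translations, so the lattice plays no role.
  suffices h : ∀ g x : V,
      ((heisCoframe a b c ha hb hc).form I (heisMul g x)).compContinuousLinearMap
      (fderiv ℝ (heisMul g) x) = (heisCoframe a b c ha hb hc).form I x from fun g _ x => h g x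
  intro g x
  rw [fderiv_heisMul]
  ext v
  have h (w : V) : (heisCoframe a b c ha hb hc).coframe (heisMul g x) (heisLeft g w) =
      (heisCoframe a b c ha hb hc).coframe x w := by
    rw [heisCoframe_coframe_apply, heisCoframe_coframe_apply, heisLeft_apply]
    funext i
    fin_cases i <;> simp [heisMul]
    ring
  rw [ContinuousAlternatingMap.compContinuousLinearMap_apply, Coframe.form_apply,
    Coframe.form_apply]
  simp only [Function.comp_apply, h]

/-! ## The metric of `Θ` and the instanton condition -/

namespace Coframe

variable (e : Coframe)

theorem form_three_apply_frame (p q r k l : Fin 7) (x v : V) :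
    e.form ![p, q, r] x ![v, e.frame k x, e.frame l x] =
      e.coframe x v p * ((if q = k then 1 else 0) * (if r = l then 1 else 0) -
        (if q = l then 1 else 0) * (if r = k then 1 else 0)) -
      e.coframe x v q * ((if p = k then 1 else 0) * (if r = l then 1 else 0) -
        (if p = l then 1 else 0) * (if r = k then 1 else 0)) +
      e.coframe x v r * ((if p = k then 1 else 0) * (if q = l then 1 else 0) -
        (if p = l then 1 else 0) * (if q = k then 1 else 0)) := by
  have h (i j : Fin 7) : (if i = j then (1 : ℝ) else 0) = e.coframe x (e.frame j x) i := by
    rw [e.dual, Pi.single_apply]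
  simp only [h, form_apply, Matrix.det_fin_three, Matrix.of_apply, Matrix.cons_val_zero,
    Matrix.cons_val_one, Matrix.cons_val]
  ring

/-- Generalized Laplace expansion by complementary 2 × 2 minors. -/
theorem comp_form_four (p q r s i j k l : Fin 7) (x : V) :
    e.comp (e.form ![p, q, r, s]) x ![i, j, k, l] =
      e.comp (e.form ![p, q]) x ![i, j] * e.comp (e.form ![r, s]) x ![k, l] -
      e.comp (e.form ![p, q]) x ![i, k] * e.comp (e.form ![r, s]) x ![j, l] +
      e.comp (e.form ![p, q]) x ![i, l] * e.comp (e.form ![r, s]) x ![j, k] +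
      e.comp (e.form ![p, q]) x ![j, k] * e.comp (e.form ![r, s]) x ![i, l] -
      e.comp (e.form ![p, q]) x ![j, l] * e.comp (e.form ![r, s]) x ![i, k] +
      e.comp (e.form ![p, q]) x ![k, l] * e.comp (e.form ![r, s]) x ![i, j] := by
  simp only [comp, form_apply, Matrix.det_succ_row_zero (n := 3), Fin.sum_univ_four,
    Matrix.det_fin_three, Matrix.det_fin_two, Matrix.submatrix_apply, Matrix.of_apply]
  simp [Fin.succAbove]
  ring

set_option maxHeartbeats 1000000 in
theorem metricInducedByTheta : e.MetricInducedByTheta := by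
  intro x v w
  simp only [theta, Pi.add_apply, Pi.sub_apply, ContinuousAlternatingMap.add_apply,
    ContinuousAlternatingMap.sub_apply, form_three_apply_frame, metric]
  -- What remains is an algebraic identity for the model 3-form on `ℝ⁷`.
  generalize e.coframe x v = u
  generalize e.coframe x w = u'
  simp [Fin.sum_univ_seven]
  ring

-- The only terms of `*Θ` containing both indices 1 and 2 are `e^{1234}` and `e^{1256}`, so
-- contraction leaves `e^34 + e^56`. The next two lemmas treat the other pairs likewise.
set_option maxHeartbeats 1000000 in
theorem comp_starTheta_zero_one (m n : Fin 7) (x : V) :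
    e.comp e.starTheta x ![m, n, 0, 1] = blockSkew 0 1 1 m n := by
  simp only [starTheta_eq, comp_add, comp_sub, comp_form_four, comp_form_two]
  fin_cases m <;> fin_cases n <;> simp [blockSkew]

set_option maxHeartbeats 1000000 in
theorem comp_starTheta_two_three (m n : Fin 7) (x : V) :
    e.comp e.starTheta x ![m, n, 2, 3] = blockSkew 1 0 1 m n := by
  simp only [starTheta_eq, comp_add, comp_sub, comp_form_four, comp_form_two]
  fin_cases m <;> fin_cases n <;> simp [blockSkew]

set_option maxHeartbeats 1000000 in
theorem comp_starTheta_four_five (m n : Fin 7) (x : V) :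
    e.comp e.starTheta x ![m, n, 4, 5] = blockSkew 1 1 0 m n := by
  simp only [starTheta_eq, comp_add, comp_sub, comp_form_four, comp_form_two]
  fin_cases m <;> fin_cases n <;> simp [blockSkew]

theorem comp_swap_last (α : Form 4) (x : V) (m n k l : Fin 7) :
    e.comp α x ![m, n, l, k] = -e.comp α x ![m, n, k, l] := by
  have h := (α x).map_swap (fun a => e.frame (![m, n, k, l] a) x) (i := 2) (j := 3) (by decide)
  refine Eq.trans (congrArg (α x) ?_) h
  funext a
  fin_cases a <;> rfl

theorem sum_blockSkew_comp_starTheta (a b c : ℝ) (habc : a + b + c = 0) (m n : Fin 7) (x : V) :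
    ∑ k, ∑ l, blockSkew a b c k l * e.comp e.starTheta x ![m, n, k, l] =
      -2 * blockSkew a b c m n := by
  have h : ∑ k, ∑ l, blockSkew a b c k l * e.comp e.starTheta x ![m, n, k, l] =
      2 * (a * e.comp e.starTheta x ![m, n, 0, 1] + b * e.comp e.starTheta x ![m, n, 2, 3] +
        c * e.comp e.starTheta x ![m, n, 4, 5]) := by
    simp only [Fin.sum_univ_seven]
    rw [e.comp_swap_last _ x m n 0 1, e.comp_swap_last _ x m n 2 3, e.comp_swap_last _ x m n 4 5]
    simp [blockSkew]
    ring
  rw [h, comp_starTheta_zero_one, comp_starTheta_two_three, comp_starTheta_four_five]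
  obtain rfl : c = -a - b := by linarith
  fin_cases m <;> fin_cases n <;> simp [blockSkew] <;> ring

end Coframe

/-! ## The equations of motion -/

theorem Coframe.covDeriv_const (e : Coframe) (σ : Conn) {k : ℕ} (t : (Fin k → Fin 7) → ℝ) (x : V)
    (i : Fin 7) (I : Fin k → Fin 7) :
    e.covDeriv σ (fun _ => t) x i I =
      -∑ a, ∑ s, e.comp (σ s (I a)) x ![i] * t (Function.update I a s) := by
  rw [Coframe.covDeriv, fderiv_fun_const]
  simp

theorem blockSkew_six_left (p q r : ℝ) (j : Fin 7) : blockSkew p q r 6 j = 0 := by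
  fin_cases j <;> simp [blockSkew]

theorem blockSkew_six_right (p q r : ℝ) (j : Fin 7) : blockSkew p q r j 6 = 0 := by
  fin_cases j <;> simp [blockSkew]

section Heisenberg

variable (a b c : ℝ) (ha : a ≠ 0) (hb : b ≠ 0) (hc : c ≠ 0)

theorem heisCoframe_ricci (i j : Fin 7) (x : V) :
    (heisCoframe a b c ha hb hc).ricci (heisCoframe a b c ha hb hc).leviCivita i j x =
      ∑ k, (heisChristoffel a b c k j 6 * blockSkew a b c k i +
        ∑ s, (heisChristoffel a b c k s k * heisChristoffel a b c s j i -
          heisChristoffel a b c k s i * heisChristoffel a b c s j k)) := by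
  simp only [Coframe.ricci, heisCoframe_comp_leviCivita_curvature]

theorem heisCoframe_isG2Instanton (habc : a + b + c = 0) (l m t : ℝ) :
    (heisCoframe a b c ha hb hc).IsG2Instanton
      (instantonConn (heisCoframe a b c ha hb hc) l m t) := by
  refine ⟨Coframe.instantonConn_isMetric _ l m t, fun p q i j x => ?_⟩
  have h := (heisCoframe a b c ha hb hc).sum_blockSkew_comp_starTheta a b c habc i j x
  simp only [heisCoframe_comp_curvature_instantonConn, mul_assoc, ← Finset.mul_sum]
  rw [h]
  ring

theorem heisCoframe_killingSpinorEquations (habc : a + b + c = 0) (l m t φ₀ : ℝ) :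
    (heisCoframe a b c ha hb hc).KillingSpinorEquations (heisCoframe a b c ha hb hc).torsion
      (fun _ => φ₀) (instantonConn (heisCoframe a b c ha hb hc) l m t) fun _ => spinorRe where
  gravitino x k := by
    have h := sum_blockSkew_gamma_swap_spinorRe (-a) (-b) (-c) (by linarith)
    rw [Coframe.spinDeriv, heisCoframe_plusConn a b c ha hb hc habc, fderiv_fun_const]
    simp only [Coframe.comp_instantonConn, mul_comm _ (ite _ _ _), mul_smul, ← Finset.smul_sum]
    rw [h]
    simp
  dilatino x := by
    have h := sum_heisFlux_gamma_spinorRe a b c habc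
    simp only [heisCoframe_comp_torsion a b c ha hb hc habc]
    rw [h, fderiv_fun_const]
    simp
  gaugino x p q := by
    have h := sum_blockSkew_gamma_spinorRe a b c habc
    simp only [heisCoframe_comp_curvature_instantonConn, mul_smul, ← Finset.smul_sum]
    rw [h, smul_zero]

theorem heisCoframe_equationsOfMotion (habc : a + b + c = 0) (l m t φ₀ α' : ℝ)
    (hα' : α' * (a ^ 2 + b ^ 2 + c ^ 2 - (l ^ 2 + m ^ 2 + t ^ 2)) = 4) :
    (heisCoframe a b c ha hb hc).EquationsOfMotion (heisCoframe a b c ha hb hc).torsion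
      (fun _ => φ₀) (instantonConn (heisCoframe a b c ha hb hc) (-a) (-b) (-c))
      (instantonConn (heisCoframe a b c ha hb hc) l m t) α' where
  einstein x i j := by
    have h := heisFlux_einstein a b c i j
    simp only [fderiv_fun_const, Pi.zero_apply, zero_apply]
    rw [Coframe.covDeriv_const, heisCoframe_ricci, heisCoframe_curvatureSquare_instantonConn,
      heisCoframe_curvatureSquare_instantonConn]
    simp only [heisCoframe_comp_torsion a b c ha hb hc habc, mul_zero, Finset.sum_const_zero,
      neg_zero, add_zero]
    -- Both curvature squares are multiples of `∑ ω_ik ω_jk`, and `hα'` makes the total coefficient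
    -- of the curvature term `1`.
    linear_combination h + (1 / 4 * ∑ k, blockSkew a b c i k * blockSkew a b c j k) * hα'
  flux x j k := by
    have ht : (fun y => Real.exp (-2 * φ₀) •
        (heisCoframe a b c ha hb hc).comp (heisCoframe a b c ha hb hc).torsion y) =
        fun _ I => Real.exp (-2 * φ₀) * heisFlux a b c (I 0) (I 1) (I 2) := by
      funext y I
      rw [Pi.smul_apply, smul_eq_mul, ← heisCoframe_comp_torsion a b c ha hb hc habc _ _ _ y]
      congr 2
      funext s
      fin_cases s <;> rfl
    rw [ht]
    simp only [Coframe.covDeriv_const, heisCoframe_comp_leviCivita, Fin.sum_univ_three]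
    have h := heisFlux_divergence a b c j k
    rw [← neg_eq_zero, ← Finset.sum_neg_distrib, ← mul_zero (Real.exp (-2 * φ₀)), ← h,
      Finset.mul_sum]
    refine Finset.sum_congr rfl fun i _ => ?_
    rw [neg_neg, Finset.mul_sum, ← Finset.sum_add_distrib, ← Finset.sum_add_distrib]
    refine Finset.sum_congr rfl fun s _ => ?_
    simp [Function.update]
    ring
  gauge x j p q := by
    have ht : (fun y => Real.exp (-2 * φ₀) • (heisCoframe a b c ha hb hc).comp
        ((instantonConn (heisCoframe a b c ha hb hc) l m t).curvature p q) y) =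
        fun _ I => Real.exp (-2 * φ₀) * (blockSkew l m t p q * blockSkew a b c (I 0) (I 1)) := by
      funext y I
      rw [Pi.smul_apply, smul_eq_mul,
        ← heisCoframe_comp_curvature_instantonConn a b c ha hb hc l m t p q _ _ y]
      congr 2
      funext s
      fin_cases s <;> rfl
    rw [ht]
    -- Each summand vanishes separately: for `i ≠ 6` the connection forms vanish on `E_i`, and for
    -- `i = 6` one has `ω(E_7, ·) = 0`.
    refine Finset.sum_eq_zero fun i _ => ?_
    rw [Coframe.covDeriv_const, heisCoframe_plusConn a b c ha hb hc habc]
    simp only [heisCoframe_comp_curvature_instantonConn, Coframe.comp_instantonConn,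
      Fin.sum_univ_two]
    by_cases hi : i = 6
    · subst hi
      simp [Function.update, blockSkew_six_left, blockSkew_six_right]
    · simp [hi]

end Heisenberg

end Heterotic

end

/-! ### Main theorem -/

open Heterotic in
open scoped ContDiff in
theorem theorem5p8 (a b l m t φ₀ : ℝ) (ha : a ≠ 0) (hb : b ≠ 0) (hc : -a - b ≠ 0)
    (hne : (l, m, t) ≠ (0, 0, 0))
    (hlt : l ^ 2 + m ^ 2 + t ^ 2 < 2 * (a ^ 2 + a * b + b ^ 2))
    (e : Coframe) (he : e = heisCoframe a b (-a - b) ha hb hc)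
    (T : Form 3) (hT : T = e.torsion)
    (nablaPlus : Conn) (hplus : nablaPlus = e.plusConn T)
    (A : Conn) (hA : A = instantonConn e l m t)
    (α' : ℝ) (hα' : α' = 4 * (2 * (a ^ 2 + a * b + b ^ 2) - l ^ 2 - m ^ 2 - t ^ 2)⁻¹) :
    -- `N(3,1)` is a compact manifold, covered by `H(3,1)` with deck group `Γ(3,1)`
    (IsQuotientCoveringMap toN31 Gamma31 ∧ T2Space N31 ∧ CompactSpace N31) ∧
    -- the data are defined on `N(3,1)`
    ((∀ i, DescendsForm (e.form ![i])) ∧ DescendsForm e.theta ∧ DescendsForm T ∧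
      ∀ i j, DescendsForm (nablaPlus i j) ∧ DescendsForm (A i j)) ∧
    -- the `G₂`-structure is cocalibrated of pure type, and `A` is a `G₂`-instanton
    (e.MetricInducedByTheta ∧ e.CocalibratedOfPureType ∧ e.IsG2Instanton A) ∧
    -- anomaly cancellation
    (0 < α' ∧
      extDeriv T = (2 * Real.pi ^ 2 * α') • (nablaPlus.pontrjagin - A.pontrjagin)) ∧
    -- the supersymmetry equations, with constant dilaton
    (∃ ε : V → Spinor, ContDiff ℝ ∞ ε ∧ DescendsFun ε ∧ (∀ x, ε x ≠ 0) ∧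
      e.KillingSpinorEquations T (fun _ => φ₀) A ε) ∧
    -- the equations of motion, with the same `α'`
    e.EquationsOfMotion T (fun _ => φ₀) nablaPlus A α' ∧
    -- the flux and the instanton curvature are nonzero
    ((∀ x, T x ≠ 0) ∧ ∀ x, ∃ p q, A.curvature p q x ≠ 0) ∧
    -- the metric in coordinates
    (∀ x v w : V, e.metric x v w =
      1 / a ^ 2 * (v 0 * w 0) + v 1 * w 1 + 1 / b ^ 2 * (v 2 * w 2) + v 3 * w 3 +
        1 / (a + b) ^ 2 * (v 4 * w 4) + v 5 * w 5 +
        (x 0 * v 1 + x 2 * v 3 + x 4 * v 5 - v 6) * (x 0 * w 1 + x 2 * w 3 + x 4 * w 5 - w 6)) := by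
  have habc : a + b + (-a - b) = 0 := by ring
  have hpos : 0 < 2 * (a ^ 2 + a * b + b ^ 2) - l ^ 2 - m ^ 2 - t ^ 2 := by linarith
  -- With `c = -a - b`, one has `a² + b² + c² = 2 (a² + ab + b²)`; this is the single scalar
  -- equation behind both the anomaly and the Einstein equation.
  have hα : α' * (a ^ 2 + b ^ 2 + (-a - b) ^ 2 - (l ^ 2 + m ^ 2 + t ^ 2)) = 4 := by
    rw [hα', show a ^ 2 + b ^ 2 + (-a - b) ^ 2 - (l ^ 2 + m ^ 2 + t ^ 2) =
      2 * (a ^ 2 + a * b + b ^ 2) - l ^ 2 - m ^ 2 - t ^ 2 by ring,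
      mul_assoc, inv_mul_cancel₀ hpos.ne', mul_one]
  have hdesc {k : ℕ} (I : Fin k → Fin 7) : DescendsForm (e.form I) :=
    he ▸ heisCoframe_descendsForm_form a b (-a - b) ha hb hc I
  have hP : nablaPlus = instantonConn e (-a) (-b) (-(-a - b)) := by
    rw [hplus, hT, he, heisCoframe_plusConn a b (-a - b) ha hb hc habc]
  refine ⟨⟨isQuotientCoveringMap_toN31, t2Space_N31, compactSpace_N31⟩,
    ⟨fun i => hdesc _, ?_, ?_, fun i j => ⟨?_, ?_⟩⟩,
    ⟨e.metricInducedByTheta, ⟨?_, ?_⟩, ?_⟩, ⟨?_, ?_⟩,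
    ⟨fun _ => spinorRe, contDiff_const, fun _ _ _ => rfl, fun _ => ?_, ?_⟩, ?_,
    ⟨fun x => ?_, fun x => ?_⟩, fun x v w => ?_⟩
  · exact descendsForm_add (descendsForm_sub (descendsForm_sub (descendsForm_add
      (descendsForm_add (descendsForm_sub (hdesc _) (hdesc _)) (hdesc _)) (hdesc _)) (hdesc _))
      (hdesc _)) (hdesc _)
  · rw [hT, he, heisCoframe_torsion a b (-a - b) ha hb hc habc, ← he]
    exact descendsForm_add (descendsForm_add (descendsForm_smul _ (hdesc _))
      (descendsForm_smul _ (hdesc _))) (descendsForm_smul _ (hdesc _))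
  · rw [hP, instantonConn_apply]
    exact descendsForm_smul _ (hdesc _)
  · rw [hA, instantonConn_apply]
    exact descendsForm_smul _ (hdesc _)
  · rw [he, heisCoframe_extDeriv_starTheta]
  · rw [he, heisCoframe_wedge_extDeriv_theta_theta a b (-a - b) ha hb hc habc]
  · rw [hA, he]
    exact heisCoframe_isG2Instanton a b (-a - b) ha hb hc habc l m t
  · rw [hα']
    positivity
  · rw [hP, hA, hT, he, heisCoframe_extDeriv_torsion a b (-a - b) ha hb hc habc,
      heisCoframe_pontrjagin_instantonConn, heisCoframe_pontrjagin_instantonConn]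
    have h1 : 2 * Real.pi ^ 2 * α' * (((-a) ^ 2 + (-b) ^ 2 + (-(-a - b)) ^ 2) / (8 * Real.pi ^ 2) -
        (l ^ 2 + m ^ 2 + t ^ 2) / (8 * Real.pi ^ 2)) = 1 := by
      have := Real.pi_ne_zero
      field_simp
      linear_combination 2 * hα
    have key (η : Form 4) : η = (2 * Real.pi ^ 2 * α') •
        ((((-a) ^ 2 + (-b) ^ 2 + (-(-a - b)) ^ 2) / (8 * Real.pi ^ 2)) • η -
          ((l ^ 2 + m ^ 2 + t ^ 2) / (8 * Real.pi ^ 2)) • η) := by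
      funext x
      ext v
      change η x v = _ * (_ * η x v - _ * η x v)
      linear_combination -(η x v) * h1
    exact key _
  · intro h
    have := congrFun h (0, 0, 0)
    simp [spinorRe] at this
  · rw [hA, hT, he]
    exact heisCoframe_killingSpinorEquations a b (-a - b) ha hb hc habc l m t φ₀
  · rw [hP, hA, hT, he]
    exact heisCoframe_equationsOfMotion a b (-a - b) ha hb hc habc l m t φ₀ α' hα
  · intro h
    have h1 := heisCoframe_comp_torsion a b (-a - b) ha hb hc habc 0 1 6 x
    rw [← he, ← hT, Coframe.comp, h] at h1
    refine ha ?_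
    simpa [heisFlux, blockSkew] using h1.symm
  · by_contra! h
    -- Evaluating on `(E_1, E_2)`, where `ω` equals `a ≠ 0`, recovers the entries of the matrix of
    -- `λ, μ, τ`.
    have h1 (p q : Fin 7) := heisCoframe_comp_curvature_instantonConn a b (-a - b) ha hb hc l m t
      p q 0 1 x
    simp only [← he, ← hA, Coframe.comp, h] at h1
    refine hne ?_
    have h2 (p q : Fin 7) : blockSkew l m t p q = 0 := by
      have h3 := h1 p q
      have h4 : blockSkew a b (-a - b) 0 1 = a := by simp [blockSkew]
      rw [h4] at h3
      exact (mul_eq_zero.1 h3.symm).resolve_right ha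
    have hl := h2 0 1
    have hm := h2 2 3
    have ht := h2 4 5
    simp [blockSkew] at hl hm ht
    rw [hl, hm, ht]
  · rw [he, Coframe.metric]
    simp only [heisCoframe_coframe_apply]
    have hab : a + b ≠ 0 := fun h => hc (by linarith)
    simp [Fin.sum_univ_seven]
    field_simp
    ring
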